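/- Let $\mathsf k$ be a field of characteristic $0$ and let $A$ be a simple, finitely generated, (left and right) Noetherian $\mathsf k$-algebra. Let $G$ be a finite group acting on $A$ by $\mathsf k$-algebra automorphisms such that no $g\neq 1$ acts as an inner automorphism $a\mapsto uau^{-1}$, and let $A^G$ be the algebra of invariants. Notation. For a $\mathsf k$-algebra $B$ generated by a finite set $S$, put $B_0=\mathsf k$, $B_1=\mathrm{span}\langle 1,S\rangle$, $B_i=B_1^i$. For a $B$-module $M$ generated by a finite-dimensional subspace $M_0$, put $M_i=B_iM_0$ and let $f(i)\in\mathbb N\cup\{\infty\}$ be the least $j$ with $B_jW\supseteq M_0$ for all finite-dimensional subspaces $W\subseteq M_i$ that generate $M$ as a $B$-module. The filter dimension of $M$ is $\inf\{r\in\mathbb R : f(i)\le i^r \text{ for all large } i\}\in[-\infty,\infty]$ (minimized over $S$ and $M_0$; it does not depend on these choices), and $\mathrm{fdim}\,B$ is the filter dimension of $B$ as a left $B\otimes_{\mathsf k}B^{op}$-module. The Gelfand-Kirillov dimensions are $$GK(B)=\sup_V\limsup_{n\to\infty}\frac{\log\dim V^n}{\log n},\qquad GK(M)=\sup_{V,F}\limsup_{n\to\infty}\frac{\log\dim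 V^nF}{\log n},$$ where $V$ runs over the finite-dimensional subspaces of $B$ containing $1$ and $F$ over the finite-dimensional subspaces of $M$. Then $\mathrm{fdim}\,A^G\le\mathrm{fdim}\,A$. Moreover, if $\mathrm{fdim}\,A=1$ and there exists a nonzero finitely generated left $A^G$-module $M$ with $GK(M)<\infty$ and $GK(M)\le\frac12\,GK(A^G)$, then $\mathrm{fdim}\,A^G=\mathrm{fdim}\,A$. -/

import Mathlib

open scoped TensorProduct

noncomputable section

namespace FilterDim

/-! ### Gelfand-Kirillov dimension -/

section GK

variable (k : Type*) [Field k]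

/-- For subspaces `V` of an algebra `A` and `F` of an `A`-module `M`, the subspace `V F`
spanned by the elements `v • m` with `v ∈ V` and `m ∈ F`. -/
def actOn {A M : Type*} [Ring A] [Algebra k A] [AddCommGroup M] [Module k M] [Module A M]
    (V : Submodule k A) (F : Submodule k M) : Submodule k M :=
  Submodule.span k {x : M | ∃ v ∈ V, ∃ m ∈ F, x = v • m}

/-- A frame of an algebra: a finite-dimensional subspace containing the identity. -/
def IsFrame {A : Type*} [Ring A] [Algebra k A] (V : Submodule k A) : Prop :=
  FiniteDimensional k V ∧ (1 : A) ∈ V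

/-- The growth exponent `limsup_{n → ∞} (log d(n)) / (log n)`, computed in `[-∞, ∞]`. -/
def growthExponent (d : ℕ → ℕ) : EReal :=
  Filter.limsup (fun n : ℕ => ((Real.log (d n : ℝ) / Real.log (n : ℝ) : ℝ) : EReal)) Filter.atTop

/-- The Gelfand-Kirillov dimension of a (nonzero) algebra. -/
def gkDim (A : Type*) [Ring A] [Algebra k A] : EReal :=
  ⨆ (V : Submodule k A) (_ : IsFrame k V),
    growthExponent fun n => Module.finrank k (V ^ n : Submodule k A)

/-- The Gelfand-Kirillov dimension of a nonzero `A`-module. (`F = 0` contributes the value `0`,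
which does not change the supremum when `M ≠ 0`.) -/
def gkDimModule (A M : Type*) [Ring A] [Algebra k A] [AddCommGroup M] [Module k M]
    [Module A M] : EReal :=
  ⨆ (V : Submodule k A) (_ : IsFrame k V) (F : Submodule k M) (_ : FiniteDimensional k F),
    growthExponent fun n => Module.finrank k (actOn k (V ^ n) F)

end GK

/-! ### Filter dimension -/

section Filter

variable (k : Type*) [Field k]

/-- The filtration of `A` attached to a finite set `S` of algebra generators:
`A₀ = k`, `A₁ = span ⟨1, S⟩`, `Aᵢ = A₁ ^ i`. -/
def stdFiltration {A : Type*} [Ring A] [Algebra k A] (S : Finset A) (i : ℕ) : Submodule k A :=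
  (Submodule.span k (insert 1 (S : Set A))) ^ i

/-- The return function `f(i) = min {j ∈ ℕ ∪ {∞} : Aⱼ W ⊇ M₀ for all W}`, where `W` runs over the
finite-dimensional subspaces of `Mᵢ = Aᵢ M₀` which generate `M` as an `A`-module. -/
def returnFunction {A M : Type*} [Ring A] [Algebra k A] [AddCommGroup M] [Module k M]
    [Module A M] (S : Finset A) (M₀ : Submodule k M) (i : ℕ) : ℕ∞ :=
  ⨅ (j : ℕ) (_ : ∀ W : Submodule k M, FiniteDimensional k W →
      W ≤ actOn k (stdFiltration k S i) M₀ → Submodule.span A (W : Set M) = ⊤ →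
      M₀ ≤ actOn k (stdFiltration k S j) W), (j : ℕ∞)

/-- `Γ(f) = inf {r ∈ ℝ : f(i) ≤ i ^ r for all large i}`, in `[-∞, ∞]`. -/
def gammaExp (f : ℕ → ℕ∞) : EReal :=
  ⨅ (r : ℝ) (_ : ∀ᶠ i : ℕ in Filter.atTop,
      ((f i : ℕ∞) : ENNReal) ≤ ENNReal.ofReal ((i : ℝ) ^ r)), (r : EReal)

/-- The filter dimension of a finitely generated module `M` over a finitely generated algebra `A`:
the exponent `Γ` of the return function attached to a finite set `S` of algebra generators of `A`
and a finite-dimensional generating subspace `M₀` of `M`. As the exponent does not depend on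
these choices, it is written as the infimum over all of them. -/
def moduleFilterDim (A M : Type*) [Ring A] [Algebra k A] [AddCommGroup M] [Module k M]
    [Module A M] : EReal :=
  ⨅ (S : Finset A) (_ : Algebra.adjoin k (S : Set A) = ⊤)
    (M₀ : Submodule k M) (_ : FiniteDimensional k M₀)
    (_ : Submodule.span A (M₀ : Set M) = ⊤), gammaExp (returnFunction k S M₀)

/-- The filter dimension of an algebra `A`: the filter dimension of `A` as a left module over
`A ⊗ Aᵒᵖ`, with the action `(a ⊗ b) • x = a x b`. -/
def filterDim (A : Type*) [Ring A] [Algebra k A] : EReal :=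
  letI : Module (A ⊗[k] Aᵐᵒᵖ) A := TensorProduct.Algebra.module
  moduleFilterDim k (A ⊗[k] Aᵐᵒᵖ) A

end Filter

/-! ### Outer actions -/

/-- `G` acts on the ring `A` by outer automorphisms: no `g ≠ 1` acts as an inner automorphism
`a ↦ u a u⁻¹`. -/
def ActsByOuter (G A : Type*) [Group G] [Ring A] [MulSemiringAction G A] : Prop :=
  ∀ g : G, g ≠ 1 → ¬ ∃ u : Aˣ, ∀ a : A, g • a = (u : A) * a * ((u⁻¹ : Aˣ) : A)

end FilterDim

end

/-! Write B for the algebra of invariants and tr for the sum over a G-orbit. For a simple algebra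
with a generating frame V, a bound r > 0 on the filter dimension amounts, up to constants and an
arbitrarily small change of r, to quantitative simplicity: every nonzero a in Vⁱ satisfies 1 ∈ Vᵐ a
Vᵐ with m of order iʳ. The two directions are `exists_returnBound_of_moduleFilterDim_lt` and
`moduleFilterDim_le`; it remains to move such bounds from A to B.

An invariant b is regarded as the constant vector in the direct sum over h of the twisted bimodules
A h, on which p ⊗ q acts in coordinate h by x ↦ p x h(q). Since the action is outer, distinct
summands are not isomorphic, so the sub-bimodule generated by b contains a unit vector.
`exists_single_mem_twistedSpan` does this with control of degrees: coordinates are killed one at a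
time by commutators, and finite rank of A × A (`exists_uniform_degree`) keeps the auxiliary elements
in bounded degree. Adding the coordinates and applying tr turns p ⊗ q into tr(p) b tr(q), while the
unit vector becomes |G|, which is invertible. A finite dual basis of A over B
(`exists_dual_subspaces`) provides a frame D of B with tr(Vᵐ) ⊆ Dᵐ⁺¹, so the return bound descends
to B with the same exponent (`exists_invariant_frame`).

For the equality, suppose fdim B < 1. If 1 ∈ Dᵐ b Dᵐ for all nonzero b in Dⁱ, then Dⁱ acts
faithfully as maps DᵐM₀ → Dᵐ⁺ⁱM₀. Taking m of order iˢ with s < 1 gives GK(B) ≤ (1 + s) GK(M), which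
contradicts GK(M) ≤ GK(B)/2 because GK(B) ≥ 1 (`not_gkDimModule_le_half`). The last inequality needs
B infinite-dimensional; otherwise A would be finite-dimensional, with filter dimension below 1. -/

namespace FilterDim

/-! ### Torsion with respect to essential left ideals and bounded chains -/

section Torsion

variable {A : Type*} [Ring A]

/-- In a simple ring an additive subgroup stable under multiplication from both sides which
contains a nonzero element contains `1`. -/
theorem one_mem_of_mul_mem [IsSimpleRing A] (S : AddSubgroup A)
    (hl : ∀ a x, x ∈ S → a * x ∈ S) (hr : ∀ a x, x ∈ S → x * a ∈ S)
    {x : A} (hx : x ∈ S) (h0 : x ≠ 0) : (1 : A) ∈ S := by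
  let I : TwoSidedIdeal A := TwoSidedIdeal.mk' (S : Set A) S.zero_mem S.add_mem S.neg_mem
    (fun {a x} h => hl a x h) (fun {x a} h => hr a x h)
  have hI : ∀ y, y ∈ I ↔ y ∈ S := fun y => by
    simp [I]
  rcases eq_bot_or_eq_top I with h | h
  · exact absurd ((TwoSidedIdeal.mem_bot A).1 (h ▸ (hI x).2 hx)) h0
  · exact (hI 1).1 (h ▸ trivial)

/-- The left singular ideal of a simple ring vanishes. -/
theorem eq_zero_of_singular [IsSimpleRing A] {x : A}
    (hx : ∀ a : A, a ≠ 0 → ∃ r, r * a ≠ 0 ∧ r * a * x = 0) : x = 0 := by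
  by_contra h0
  let S : AddSubgroup A :=
    { carrier := {x | ∀ a : A, a ≠ 0 → ∃ r, r * a ≠ 0 ∧ r * a * x = 0}
      zero_mem' := fun a ha => ⟨1, by simpa using ha, by simp⟩
      add_mem' := by
        intro x y hx hy a ha
        obtain ⟨r, h1, h2⟩ := hx a ha
        obtain ⟨s, h3, h4⟩ := hy _ h1
        refine ⟨s * r, by rwa [mul_assoc], ?_⟩
        rw [mul_add, mul_assoc s, mul_assoc s, h2, h4, mul_zero, zero_add]
      neg_mem' := by
        intro x hx a ha
        obtain ⟨r, h1, h2⟩ := hx a ha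
        exact ⟨r, h1, by rw [mul_neg, h2, neg_zero]⟩ }
  have h1 : (1 : A) ∈ S := by
    refine one_mem_of_mul_mem S ?_ ?_ (x := x) hx h0
    · intro b x hx a ha
      by_cases hab : a * b = 0
      · exact ⟨1, by simpa using ha, by rw [one_mul, ← mul_assoc, hab, zero_mul]⟩
      · obtain ⟨r, h1, h2⟩ := hx _ hab
        refine ⟨r, fun h => h1 ?_, ?_⟩
        · rw [← mul_assoc, h, zero_mul]
        · rw [← h2]; simp only [mul_assoc]
    · intro b x hx a ha
      obtain ⟨r, h1, h2⟩ := hx a ha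
      exact ⟨r, h1, by rw [← mul_assoc, h2, zero_mul]⟩
  obtain ⟨r, h2, h3⟩ := h1 1 one_ne_zero
  exact h2 (by simpa using h3)

/-- Every element of `L` is carried into `L'` by an essential left ideal. -/
def RelTorsion {M : Type*} [AddCommGroup M] [Module A M] (L' L : Submodule A M) : Prop :=
  ∀ x ∈ L, ∀ a : A, a ≠ 0 → ∃ r, r * a ≠ 0 ∧ (r * a) • x ∈ L'

/-- A descending chain of submodules of `M` has at most `n` steps that are not torsion. -/
def JumpsLE (A M : Type*) [Ring A] [AddCommGroup M] [Module A M] (n : ℕ) : Prop :=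
  ∀ L : ℕ → Submodule A M, Antitone L → ∀ s : Finset ℕ,
    (∀ i ∈ s, ¬ RelTorsion (L (i + 1)) (L i)) → s.card ≤ n

variable {M N X : Type*} [AddCommGroup M] [Module A M] [AddCommGroup N] [Module A N]
  [AddCommGroup X] [Module A X]

/-- The multipliers carrying x into L' form an essential left ideal; if all of them annihilated b,
then b would be singular, hence zero. -/
theorem RelTorsion.exists_mul_ne_zero [IsSimpleRing A] {L' L : Submodule A M}
    (h : RelTorsion L' L) {x : M} (hx : x ∈ L) {b : A} (hb : b ≠ 0) :
    ∃ e, e * b ≠ 0 ∧ e • x ∈ L' := by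
  by_contra! hc
  refine hb (eq_zero_of_singular fun a ha => ?_)
  obtain ⟨r, h1, h2⟩ := h x hx a ha
  exact ⟨r, h1, by_contra fun h3 => hc _ h3 h2⟩

/-- Torsion in the image gives a multiple of x that differs from an element of L' by something in
the image of g; a second multiplier, chosen not to annihilate the first, moves that difference into
L'. -/
theorem RelTorsion.of_exact [IsSimpleRing A] (g : X →ₗ[A] M) (f : M →ₗ[A] N)
    (hgf : Function.Exact g f) {L' L : Submodule A M} (hL : L' ≤ L)
    (h1 : RelTorsion (L'.comap g) (L.comap g)) (h2 : RelTorsion (L'.map f) (L.map f)) :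
    RelTorsion L' L := by
  intro x hx a ha
  obtain ⟨r, hr, y, hy, hxy⟩ := h2 (f x) (Submodule.mem_map_of_mem hx) a ha
  obtain ⟨z, hz⟩ := (hgf ((r * a) • x - y)).1 (by rw [map_sub, map_smul, hxy, sub_self])
  obtain ⟨e, he, hez⟩ := h1.exists_mul_ne_zero (x := z) (b := r * a)
    (by rw [Submodule.mem_comap, hz]; exact L.sub_mem (L.smul_mem _ hx) (hL hy)) hr
  refine ⟨e * r, by rwa [mul_assoc], ?_⟩
  rw [Submodule.mem_comap, map_smul, hz, smul_sub, smul_smul] at hez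
  rw [mul_assoc]
  simpa using L'.add_mem hez (L'.smul_mem e hy)

theorem JumpsLE.of_exact [IsSimpleRing A] (g : X →ₗ[A] M) (f : M →ₗ[A] N)
    (hgf : Function.Exact g f) {a b : ℕ} (hX : JumpsLE A X a) (hN : JumpsLE A N b) :
    JumpsLE A M (a + b) := by
  classical
  intro L hL s hs
  let s₁ := s.filter fun i => ¬ RelTorsion ((L (i + 1)).comap g) ((L i).comap g)
  let s₂ := s.filter fun i => ¬ RelTorsion ((L (i + 1)).map f) ((L i).map f)
  have h₁ : s₁.card ≤ a := hX (fun i => (L i).comap g)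
    (fun i j hij => Submodule.comap_mono (hL hij)) s₁ fun i hi => (Finset.mem_filter.1 hi).2
  have h₂ : s₂.card ≤ b := hN (fun i => (L i).map f)
    (fun i j hij => Submodule.map_mono (hL hij)) s₂ fun i hi => (Finset.mem_filter.1 hi).2
  have hsub : s ⊆ s₁ ∪ s₂ := by
    intro i hi
    by_contra hc
    simp only [s₁, s₂, Finset.mem_union, Finset.mem_filter, hi, true_and, not_or, not_not] at hc
    exact hs i hi (RelTorsion.of_exact g f hgf (hL (Nat.le_succ i)) hc.1 hc.2)
  calc s.card ≤ (s₁ ∪ s₂).card := Finset.card_le_card hsub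
    _ ≤ s₁.card + s₂.card := Finset.card_union_le _ _
    _ ≤ a + b := add_le_add h₁ h₂

theorem JumpsLE.of_injective (g : X →ₗ[A] M) (hg : Function.Injective g) {n : ℕ}
    (hM : JumpsLE A M n) : JumpsLE A X n := by
  intro L hL s hs
  refine hM (fun i => (L i).map g) (fun i j hij => Submodule.map_mono (hL hij)) s ?_
  intro i hi h
  refine hs i hi fun x hx a ha => ?_
  obtain ⟨r, h1, y, hy, hxy⟩ := h (g x) (Submodule.mem_map_of_mem hx) a ha
  rw [← map_smul] at hxy
  exact ⟨r, h1, hg hxy ▸ hy⟩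

theorem JumpsLE.prod [IsSimpleRing A] {a b : ℕ} (hM : JumpsLE A M a) (hN : JumpsLE A N b) :
    JumpsLE A (M × N) (a + b) :=
  JumpsLE.of_exact (LinearMap.inl A M N) (LinearMap.snd A M N)
    (by rw [LinearMap.exact_iff, LinearMap.range_inl]) hM hN

/-- In a uniform module every nonzero submodule is essential, so a step of the chain can fail to be
torsion only where the chain drops to zero. -/
theorem JumpsLE.of_uniform (h : ∀ K₁ K₂ : Submodule A M, K₁ ≠ ⊥ → K₂ ≠ ⊥ → K₁ ⊓ K₂ ≠ ⊥) :
    JumpsLE A M 1 := by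
  intro L hL s hs
  have key : ∀ i ∈ s, ∀ j ∈ s, ¬ i < j := by
    intro i hi j hj hij
    have hLj : L j ≠ ⊥ := by
      intro h0
      refine hs j hj fun x hx a ha => ⟨1, by simpa using ha, ?_⟩
      rw [h0, Submodule.mem_bot] at hx
      simp [hx]
    have hLi : L (i + 1) ≠ ⊥ := fun h0 => hLj (le_bot_iff.1 (h0 ▸ hL hij))
    refine hs i hi fun x _ a ha => ?_
    by_cases hax : a • x = 0
    · exact ⟨1, by simpa using ha, by simp [hax]⟩
    · obtain ⟨y, hy, hy0⟩ := (Submodule.ne_bot_iff _).1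
        (h (Submodule.span A {a • x}) _ (by simpa [Submodule.span_singleton_eq_bot] using hax) hLi)
      obtain ⟨r, hr⟩ := Submodule.mem_span_singleton.1 hy.1
      rw [smul_smul] at hr
      exact ⟨r, fun h0 => hy0 (by rw [← hr, h0, zero_smul]), hr ▸ hy.2⟩
  rw [Finset.card_le_one]
  intro i hi j hj
  by_contra hne
  rcases lt_or_gt_of_ne hne with h | h
  · exact key i hi j hj h
  · exact key j hj i hi h

/-- A noetherian module over a simple ring has finite rank. -/
theorem exists_jumpsLE [IsSimpleRing A] [IsNoetherian A M] : ∃ n, JumpsLE A M n := by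
  have key : ∀ L : Submodule A M, ∃ n, JumpsLE A (M ⧸ L) n := by
    intro L
    induction L using IsNoetherian.induction with
    | hgt L ih =>
      -- If M/L is not uniform, it embeds in the product of two proper quotients, to which the
      -- induction applies.
      by_cases h : ∀ K₁ K₂ : Submodule A (M ⧸ L), K₁ ≠ ⊥ → K₂ ≠ ⊥ → K₁ ⊓ K₂ ≠ ⊥
      · exact ⟨1, JumpsLE.of_uniform h⟩
      · push Not at h
        obtain ⟨K₁, K₂, h₁, h₂, h₁₂⟩ := h
        have hlt : ∀ K : Submodule A (M ⧸ L), K ≠ ⊥ → K.comap L.mkQ > L := by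
          intro K hK
          refine lt_of_le_of_ne (Submodule.le_comap_mkQ L K) fun h => hK ?_
          rw [← Submodule.map_comap_eq_of_surjective L.mkQ_surjective K, ← h,
            Submodule.mkQ_map_self]
        obtain ⟨n₁, hn₁⟩ := ih _ (hlt K₁ h₁)
        obtain ⟨n₂, hn₂⟩ := ih _ (hlt K₂ h₂)
        refine ⟨n₁ + n₂, JumpsLE.of_injective (LinearMap.prod
          (Submodule.factor (hlt K₁ h₁).le) (Submodule.factor (hlt K₂ h₂).le)) ?_ (hn₁.prod hn₂)⟩
        rw [← LinearMap.ker_eq_bot, LinearMap.ker_prod, eq_bot_iff, ← h₁₂]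
        intro x hx
        obtain ⟨m, rfl⟩ := L.mkQ_surjective x
        simpa [Submodule.factor] using hx
  obtain ⟨n, hn⟩ := key ⊥
  exact ⟨n, hn.of_injective (Submodule.mkQ ⊥) (by
    rw [← LinearMap.ker_eq_bot, Submodule.ker_mkQ])⟩

/-- Linear identities `z x u = z' σ(x) v` in `x` can be tested on a fixed step of a generating
filtration. -/
theorem exists_uniform_degree {k : Type*} [Field k] [Algebra k A] [IsSimpleRing A]
    [IsNoetherianRing A] (V : Submodule k A) (h1 : (1 : A) ∈ V) (hV : ∀ a : A, ∃ n, a ∈ V ^ n) :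
    ∃ n : ℕ, ∀ (σ : A →+* A) (u v z z' : A),
      (∀ x ∈ V ^ n, z * x * u = z' * σ x * v) → ∀ x, z * x * u = z' * σ x * v := by
  obtain ⟨n, hn⟩ := exists_jumpsLE (A := A) (M := A × A)
  refine ⟨n, fun σ u v z z' hz => ?_⟩
  have hone : (1 : Submodule k A) ≤ V := by rwa [Submodule.one_le]
  -- With σ, u, v fixed, the pairs (z, z') that satisfy the identity on Vⁱ form a descending chain
  -- of left submodules of A × A; the rank n of A × A does not depend on σ, u, v.
  let L : ℕ → Submodule A (A × A) := fun i =>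
    { carrier := {w | ∀ x ∈ V ^ i, w.1 * x * u = w.2 * σ x * v}
      zero_mem' := by simp
      add_mem' := by
        intro w w' hw hw' x hx
        simp only [Prod.fst_add, Prod.snd_add, add_mul, hw x hx, hw' x hx]
      smul_mem' := by
        intro c w hw x hx
        simp only [Prod.smul_fst, Prod.smul_snd, smul_eq_mul]
        rw [mul_assoc c, mul_assoc c, hw x hx]
        simp only [mul_assoc] }
  have hanti : Antitone L := fun i j hij w hw x hx => hw x (pow_le_pow_right₀ hone hij hx)
  have hsucc : ∀ i w, w ∈ L (i + 1) ↔ ∀ y ∈ V, (w.1 * y, w.2 * σ y) ∈ L i := by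
    intro i w
    constructor
    · intro hw y hy x hx
      have := hw (y * x) (by rw [pow_succ']; exact Submodule.mul_mem_mul hy hx)
      simpa [mul_assoc] using this
    · intro hw x hx
      rw [pow_succ'] at hx
      induction hx using Submodule.mul_induction_on' with
      | mem_mul_mem y hy x hx => simpa [mul_assoc] using hw y hy x hx
      | add x _ y _ hx hy => rw [mul_add, add_mul, hx, hy, map_add, mul_add, add_mul]
  -- If the step were torsion, the difference of the two sides of the identity would be singular,
  -- hence zero. So every strict inclusion is a counted jump.
  have htors : ∀ i, L i ≠ L (i + 1) → ¬ RelTorsion (L (i + 1)) (L i) := by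
    intro i hne ht
    refine hne (le_antisymm (fun w hw x hx => ?_) (hanti (Nat.le_succ i)))
    rw [← sub_eq_zero]
    refine eq_zero_of_singular fun a ha => ?_
    obtain ⟨r, hr, h⟩ := ht w hw a ha
    refine ⟨r, hr, ?_⟩
    have := h x hx
    simp only [Prod.smul_fst, Prod.smul_snd, smul_eq_mul] at this
    rw [mul_sub, sub_eq_zero]
    simpa [mul_assoc] using this
  -- By `hsucc` each term determines the next, so strict steps form an initial segment; there are at
  -- most n of them.
  have hstab : ∀ i j, i ≤ j → L i = L (i + 1) → L j = L (j + 1) := by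
    intro i j hij h
    induction j, hij using Nat.le_induction with
    | base => exact h
    | succ j _ ih =>
      ext w
      rw [hsucc, hsucc, ih]
  have hn' : L n = L (n + 1) := by
    by_contra hne
    have := hn L hanti (Finset.range (n + 1)) fun i hi => htors i fun h =>
      hne (hstab i n (Nat.lt_succ_iff.1 (Finset.mem_range.1 hi)) h)
    simp at this
  have hall : ∀ j, n ≤ j → L j = L n := by
    intro j hj
    induction j, hj using Nat.le_induction with
    | base => rfl
    | succ j hj ih => rw [← hstab n j hj hn', ih]
  intro x
  obtain ⟨j, hj⟩ := hV x
  have : (z, z') ∈ L (max n j) := by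
    rw [hall _ (le_max_left _ _)]; exact hz
  exact this x (pow_le_pow_right₀ hone (le_max_right n j) hj)

end Torsion

end FilterDim

namespace FilterDim

/-! ### Separating the twisted components of a bimodule -/

section Twisted

variable {k A G : Type*} [Field k] [Ring A] [Algebra k A] [Group G] [MulSemiringAction G A]

/-- The action of `p ⊗ q` on the direct sum of the twisted bimodules `A g`, `g ∈ G`. -/
def twist (k : Type*) {A G : Type*} [Field k] [Ring A] [Algebra k A] [Group G]
    [MulSemiringAction G A] (p q : A) : (G → A) →ₗ[k] (G → A) :=
  LinearMap.pi fun h => LinearMap.mulRight k (h • q) ∘ₗ LinearMap.mulLeft k p ∘ₗ LinearMap.proj h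

@[simp] theorem twist_apply (p q : A) (c : G → A) (h : G) :
    twist k p q c h = p * c h * h • q := rfl

/-- The span of the elements obtained from `c` by the action of `Vᵐ ⊗ Vᵐ`. -/
def twistedSpan (V : Submodule k A) (m : ℕ) (c : G → A) : Submodule k (G → A) :=
  Submodule.span k {d | ∃ p ∈ V ^ m, ∃ q ∈ V ^ m, d = twist k p q c}

theorem twist_mem_twistedSpan {V : Submodule k A} {m : ℕ} {c : G → A} {p q : A}
    (hp : p ∈ V ^ m) (hq : q ∈ V ^ m) : twist k p q c ∈ twistedSpan V m c :=
  Submodule.subset_span ⟨p, hp, q, hq, rfl⟩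

theorem twistedSpan_mono {V : Submodule k A} (h1 : 1 ≤ V) {m n : ℕ} (hmn : m ≤ n) (c : G → A) :
    twistedSpan V m c ≤ twistedSpan V n c := by
  refine Submodule.span_mono ?_
  rintro _ ⟨p, hp, q, hq, rfl⟩
  exact ⟨p, pow_le_pow_right₀ h1 hmn hp, q, pow_le_pow_right₀ h1 hmn hq, rfl⟩

theorem twistedSpan_trans {V : Submodule k A} {m n : ℕ} {c d e : G → A}
    (hd : d ∈ twistedSpan V m c) (he : e ∈ twistedSpan V n d) : e ∈ twistedSpan V (m + n) c := by
  suffices h : twistedSpan V n d ≤ twistedSpan V (m + n) c from h he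
  refine Submodule.span_le.2 ?_
  rintro _ ⟨p, hp, q, hq, rfl⟩
  suffices h : twistedSpan V m c ≤ (twistedSpan V (m + n) c).comap (twist k p q) from h hd
  refine Submodule.span_le.2 ?_
  rintro _ ⟨p', hp', q', hq', rfl⟩
  have : twist k p q (twist k p' q' c) = twist k (p * p') (q' * q) c := by
    ext h
    simp [mul_assoc, smul_mul']
  simp only [Submodule.comap_coe, Set.mem_preimage, SetLike.mem_coe, this]
  refine twist_mem_twistedSpan ?_ ?_
  · rw [add_comm, pow_add]; exact Submodule.mul_mem_mul hp hp'
  · rw [pow_add]; exact Submodule.mul_mem_mul hq' hq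

theorem apply_eq_zero_of_mem_twistedSpan {V : Submodule k A} {m : ℕ} {c d : G → A}
    (hd : d ∈ twistedSpan V m c) {h : G} (hc : c h = 0) : d h = 0 := by
  suffices H : twistedSpan V m c ≤ LinearMap.ker (LinearMap.proj (R := k) (φ := fun _ : G => A) h)
    from H hd
  refine Submodule.span_le.2 ?_
  rintro _ ⟨p, hp, q, hq, rfl⟩
  simp [hc]

theorem smul_mem_pow {V : Submodule k A} [SMulCommClass G k A] (hGV : ∀ g : G, ∀ x ∈ V, g • x ∈ V)
    (n : ℕ) (g : G) {x : A} (hx : x ∈ V ^ n) : g • x ∈ V ^ n := by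
  induction hx using Submodule.pow_induction_on_left' with
  | algebraMap r =>
    rw [Algebra.algebraMap_eq_smul_one, smul_comm, smul_one, pow_zero]
    exact Submodule.smul_mem _ _ (Submodule.one_le.1 le_rfl)
  | add x y i _ _ hx hy => rw [smul_add]; exact add_mem hx hy
  | mem_mul m hm i x _ hx =>
    rw [smul_mul', pow_succ']
    exact Submodule.mul_mem_mul (hGV g m hm) hx

theorem apply_mem_pow_of_mem_twistedSpan [SMulCommClass G k A] {V : Submodule k A}
    (hGV : ∀ g : G, ∀ x ∈ V, g • x ∈ V) {m i : ℕ} {c d : G → A} (hd : d ∈ twistedSpan V m c)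
    {h : G} (hc : c h ∈ V ^ i) : d h ∈ V ^ (i + 2 * m) := by
  suffices H : twistedSpan V m c ≤
      (V ^ (i + 2 * m)).comap (LinearMap.proj (R := k) (φ := fun _ : G => A) h) from H hd
  refine Submodule.span_le.2 ?_
  rintro _ ⟨p, hp, q, hq, rfl⟩
  have : i + 2 * m = m + i + m := by ring
  simp only [Submodule.comap_coe, Set.mem_preimage, SetLike.mem_coe, LinearMap.proj_apply,
    twist_apply, this, pow_add]
  exact Submodule.mul_mem_mul (Submodule.mul_mem_mul hp hc) (smul_mem_pow hGV m h hq)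

theorem exists_mem_twistedSpan_apply_eq [SMulCommClass G k A] {V : Submodule k A}
    (hGV : ∀ g : G, ∀ x ∈ V, g • x ∈ V) {m : ℕ} (c : G → A) (g : G) {y : A}
    (hy : y ∈ V ^ m * Submodule.span k {c g} * V ^ m) : ∃ d ∈ twistedSpan V m c, d g = y := by
  suffices H : V ^ m * Submodule.span k {c g} * V ^ m ≤
      (twistedSpan V m c).map (LinearMap.proj (R := k) (φ := fun _ : G => A) g) from H hy
  refine Submodule.mul_le.2 fun x hx q hq => ?_
  induction hx using Submodule.mul_induction_on' with
  | mem_mul_mem p hp z hz =>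
    obtain ⟨t, rfl⟩ := Submodule.mem_span_singleton.1 hz
    refine ⟨t • twist k p (g⁻¹ • q) c, Submodule.smul_mem _ _
      (twist_mem_twistedSpan hp (smul_mem_pow hGV m _ hq)), ?_⟩
    simp
  | add x _ y _ hx hy => rw [add_mul]; exact add_mem hx hy

/-! ### Outerness and elimination of coordinates. -/

variable [IsSimpleRing A]

/-- The left ideal A u is two-sided, so simplicity makes u invertible, and then g acts as
conjugation by u⁻¹. -/
theorem eq_one_of_intertwines (hG : ActsByOuter G A) {g : G} {u : A} (hu : u ≠ 0)
    (h : ∀ a : A, a * u = u * g • a) : g = 1 := by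
  by_contra hg
  obtain ⟨y, hy⟩ : ∃ y, y * u = 1 := by
    let S : AddSubgroup A := (LinearMap.mulRight ℤ u).range.toAddSubgroup
    have := one_mem_of_mul_mem S (x := u) ?_ ?_ ⟨1, by simp⟩ hu
    · exact this
    · rintro a _ ⟨y, rfl⟩
      exact ⟨a * y, by simp [mul_assoc]⟩
    · rintro a _ ⟨y, rfl⟩
      refine ⟨y * g⁻¹ • a, ?_⟩
      simp only [LinearMap.mulRight_apply, mul_assoc, h, smul_mul', smul_inv_smul]
  obtain ⟨z, hz⟩ : ∃ z, u * z = 1 := ⟨g • y, by rw [← h, hy]⟩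
  have hyz : y = z := left_inv_eq_right_inv hy hz
  refine hG g hg ⟨⟨y, u, hy, hyz ▸ hz⟩, fun a => ?_⟩
  change g • a = y * a * u
  rw [mul_assoc, h, ← mul_assoc, hy, one_mul]

/-- If equality held for every x, the sub-bimodule of A ⊕ A g generated by (b, b') would be the
graph of a bimodule map from A to its twist by g. The image u of 1 would then be a nonzero element
intertwining the identity and g. -/
theorem exists_commutator_ne_zero (hG : ActsByOuter G A) {g : G} (hg : g ≠ 1) {b b' : A}
    (hb : b ≠ 0) (hb' : b' ≠ 0) : ∃ x, b * x * b' ≠ b' * g • x * g • b := by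
  by_contra! hx
  let W : AddSubgroup (A × A) := AddSubgroup.closure
    {w | ∃ p q : A, w = (p * b * q, p * b' * g • q)}
  have hW : ∀ w ∈ W, ∀ x, w.2 * g • (x * b) = w.1 * x * b' := by
    intro w hw x
    induction hw using AddSubgroup.closure_induction with
    | mem w hw =>
      obtain ⟨p, q, rfl⟩ := hw
      have := congrArg (p * ·) (hx (q * x))
      simp only [smul_mul', mul_assoc] at this ⊢
      exact this.symm
    | zero => simp
    | add w w' _ _ h h' => simp only [Prod.fst_add, Prod.snd_add, add_mul, h, h']
    | neg w _ h => simp only [Prod.fst_neg, Prod.snd_neg, neg_mul, h]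
  have hWl : ∀ a, ∀ w ∈ W, (a * w.1, a * w.2) ∈ W := by
    intro a w hw
    induction hw using AddSubgroup.closure_induction with
    | mem w hw =>
      obtain ⟨p, q, rfl⟩ := hw
      exact AddSubgroup.subset_closure ⟨a * p, q, by simp [mul_assoc]⟩
    | zero => simp only [Prod.fst_zero, Prod.snd_zero, mul_zero]; exact W.zero_mem
    | add w w' _ _ h h' => simpa [mul_add] using W.add_mem h h'
    | neg w _ h => simpa using W.neg_mem h
  have hWr : ∀ a, ∀ w ∈ W, (w.1 * a, w.2 * g • a) ∈ W := by
    intro a w hw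
    induction hw using AddSubgroup.closure_induction with
    | mem w hw =>
      obtain ⟨p, q, rfl⟩ := hw
      exact AddSubgroup.subset_closure ⟨p, q * a, by simp [mul_assoc]⟩
    | zero => simp only [Prod.fst_zero, Prod.snd_zero, zero_mul]; exact W.zero_mem
    | add w w' _ _ h h' => simpa [add_mul] using W.add_mem h h'
    | neg w _ h => simpa using W.neg_mem h
  -- The first coordinates of W form a two-sided ideal containing b ≠ 0.
  obtain ⟨⟨s, u⟩, hu, rfl : s = 1⟩ := one_mem_of_mul_mem (W.map (AddMonoidHom.fst A A))
    (by rintro a _ ⟨w, hw, rfl⟩; exact ⟨_, hWl a w hw, rfl⟩)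
    (by rintro a _ ⟨w, hw, rfl⟩; exact ⟨_, hWr a w hw, rfl⟩)
    (x := b) ⟨(b, b'), AddSubgroup.subset_closure ⟨1, 1, by simp⟩, rfl⟩ hb
  have hzero : ∀ y : A, (∀ x, y * g • (x * b) = 0) → y = 0 := by
    intro y hy
    let S : AddSubgroup A :=
      { carrier := {s | ∀ x, y * g • (x * s) = 0}
        zero_mem' := by simp
        add_mem' := by
          intro s t hs ht x
          rw [mul_add, smul_add, mul_add, hs, ht, add_zero]
        neg_mem' := by
          intro s hs x
          rw [mul_neg, smul_neg, mul_neg, hs, neg_zero] }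
    have : (1 : A) ∈ S := one_mem_of_mul_mem S (x := b)
      (fun a s hs x => by rw [← mul_assoc]; exact hs (x * a))
      (fun a s hs x => by rw [← mul_assoc, smul_mul', ← mul_assoc, hs, zero_mul]) hy hb
    simpa using this 1
  refine hg (eq_one_of_intertwines hG (u := u) ?_ fun a => ?_)
  · rintro rfl
    have := hW _ hu 1
    simp only [zero_mul, one_mul] at this
    exact hb' this.symm
  · rw [← sub_eq_zero]
    -- The pairs (a, a u) and (a, u g(a)) both lie in W and share their first coordinate; `hW` then
    -- forces equal second coordinates.
    refine hzero _ fun x => ?_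
    have h1 := hW _ (hWl a _ hu) x
    have h2 := hW _ (hWr a _ hu) x
    simp only [mul_one, one_mul] at h1 h2
    rw [sub_mul, h1, h2, sub_self]

variable [SMulCommClass G k A] [IsNoetherianRing A]

/-- Two ways of killing a coordinate are combined. Cross-multiplication by c g costs about i; first
normalising c g to 1 costs about t. The cheaper one gives the minimum: the bound by i keeps the
degree of d linear in i, and the bound by t keeps the total cost linear in the return bound. -/
theorem exists_mem_twistedSpan_smaller_support (hG : ActsByOuter G A) (V : Submodule k A)
    (h1 : (1 : A) ∈ V) (hV : ∀ a : A, ∃ n, a ∈ V ^ n) (hGV : ∀ g : G, ∀ x ∈ V, g • x ∈ V) :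
    ∃ N : ℕ, ∀ (i t : ℕ) (c : G → A) (g h : G), (∀ j, c j ∈ V ^ i) → g ≠ h → c g ≠ 0 → c h ≠ 0 →
      (1 : A) ∈ V ^ t * Submodule.span k {c g} * V ^ t →
      ∃ d ∈ twistedSpan V (min t i + N) c, d ≠ 0 ∧ ∃ g', c g' ≠ 0 ∧ d g' = 0 := by
  have hone : (1 : Submodule k A) ≤ V := by rwa [Submodule.one_le]
  obtain ⟨n, hn⟩ := exists_uniform_degree V h1 hV
  refine ⟨n + 1, fun i t c g h hci hgh hcg hch ht => ?_⟩
  have hhg : h * g⁻¹ ≠ 1 := fun h' => hgh (mul_inv_eq_one.1 h').symm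
  rcases le_total i t with hit | hit
  · rw [min_eq_right hit]
    -- A suitable x exists somewhere in A by outerness; the uniform degree n then places one in Vⁿ,
    -- whatever c, g and h are.
    obtain ⟨x, hx, hne⟩ : ∃ x ∈ V ^ n, c g * x * c h ≠ c h * (h * g⁻¹) • x * (h * g⁻¹) • c g := by
      by_contra! hx
      obtain ⟨x, hx'⟩ := exists_commutator_ne_zero hG hhg hcg hch
      exact hx' (hn (MulSemiringAction.toRingHom G A (h * g⁻¹)) (c h) ((h * g⁻¹) • c g)
        (c g) (c h) hx x)
    refine ⟨twist k (c g * x) 1 c - twist k 1 (g⁻¹ • (x * c g)) c, ?_, ?_, g, hcg, ?_⟩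
    · refine twistedSpan_mono hone (by omega : i + n ≤ i + (n + 1)) c (sub_mem ?_ ?_)
      · refine twist_mem_twistedSpan ?_ (Submodule.one_le.1 (one_le_pow₀ hone))
        rw [pow_add]; exact Submodule.mul_mem_mul (hci g) hx
      · refine twist_mem_twistedSpan (Submodule.one_le.1 (one_le_pow₀ hone))
          (smul_mem_pow hGV _ _ ?_)
        rw [add_comm, pow_add]; exact Submodule.mul_mem_mul hx (hci g)
    · intro h0
      have := congrFun h0 h
      simp only [Pi.sub_apply, twist_apply, Pi.zero_apply, smul_one, mul_one, one_mul, smul_smul,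
        smul_mul', sub_eq_zero] at this
      exact hne (by rw [this, mul_assoc])
    · simp [mul_assoc]
  · rw [min_eq_left hit]
    obtain ⟨d, hd, hdg⟩ := exists_mem_twistedSpan_apply_eq hGV c g ht
    by_cases hdh : d h = 0
    · refine ⟨d, twistedSpan_mono hone (by omega) c hd, ?_, h, hch, hdh⟩
      rintro rfl
      exact one_ne_zero hdg.symm
    -- Since d g = 1, the commutator of v with d vanishes at g. If it vanished at h for all v in V,
    -- which generates A, then d h would intertwine and force h = g.
    obtain ⟨v, hv, hne⟩ : ∃ v ∈ V, v * d h ≠ d h * (h * g⁻¹) • v := by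
      by_contra! hv
      refine hhg (eq_one_of_intertwines hG hdh fun a => ?_)
      obtain ⟨j, hj⟩ := hV a
      induction hj using Submodule.pow_induction_on_left' with
      | algebraMap r =>
        rw [Algebra.algebraMap_eq_smul_one, smul_comm, smul_one]
        simp
      | add x y i _ _ hx hy => rw [smul_add, mul_add, add_mul, hx, hy]
      | mem_mul m hm i x _ hx =>
        rw [smul_mul', mul_assoc, hx, ← mul_assoc, hv m hm, mul_assoc]
    refine ⟨twist k v 1 d - twist k 1 (g⁻¹ • v) d, ?_, ?_, g, hcg, ?_⟩
    · refine twistedSpan_mono hone (by omega : t + 1 ≤ t + (n + 1)) c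
        (twistedSpan_trans hd (sub_mem ?_ ?_))
      · exact twist_mem_twistedSpan (by rwa [pow_one]) (by rwa [pow_one])
      · exact twist_mem_twistedSpan (by rwa [pow_one]) (by rw [pow_one]; exact hGV _ _ hv)
    · intro h0
      have := congrFun h0 h
      simp only [Pi.sub_apply, twist_apply, Pi.zero_apply, smul_one, mul_one, one_mul, smul_smul,
        sub_eq_zero] at this
      exact hne this
    · simp [hdg]

/-- Induction on the size of the support. Degrees grow by affine functions of i only, so F is never
composed with itself and its growth exponent survives; C is chosen before F. -/
theorem exists_single_mem_twistedSpan [Finite G] [DecidableEq G] (hG : ActsByOuter G A)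
    (V : Submodule k A) (h1 : (1 : A) ∈ V) (hV : ∀ a : A, ∃ n, a ∈ V ^ n)
    (hGV : ∀ g : G, ∀ x ∈ V, g • x ∈ V) :
    ∃ C : ℕ, ∀ F : ℕ → ℕ, Monotone F →
      (∀ i, ∀ a ∈ V ^ i, a ≠ 0 → (1 : A) ∈ V ^ F i * Submodule.span k {a} * V ^ F i) →
      ∀ (i : ℕ) (c : G → A), c ≠ 0 → (∀ j, c j ∈ V ^ i) →
        ∃ g, (Pi.single g 1 : G → A) ∈ twistedSpan V (C * (F (C * (i + 1)) + 1)) c := by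
  classical
  cases nonempty_fintype G
  have hone : (1 : Submodule k A) ≤ V := by rwa [Submodule.one_le]
  obtain ⟨N, hN⟩ := exists_mem_twistedSpan_smaller_support hG V h1 hV hGV
  suffices H : ∀ n : ℕ, ∃ C : ℕ, ∀ F : ℕ → ℕ, Monotone F →
      (∀ i, ∀ a ∈ V ^ i, a ≠ 0 → (1 : A) ∈ V ^ F i * Submodule.span k {a} * V ^ F i) →
      ∀ (i : ℕ) (c : G → A), (Finset.univ.filter fun j => c j ≠ 0).card ≤ n → c ≠ 0 →
        (∀ j, c j ∈ V ^ i) →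
        ∃ g, (Pi.single g 1 : G → A) ∈ twistedSpan V (C * (F (C * (i + 1)) + 1)) c by
    obtain ⟨C, hC⟩ := H (Finset.univ : Finset G).card
    exact ⟨C, fun F hF hF' i c => hC F hF hF' i c (Finset.card_filter_le _ _)⟩
  intro n
  induction n with
  | zero =>
    refine ⟨0, fun F _ _ i c hc hc0 => absurd (funext fun j => ?_) hc0⟩
    by_contra hj
    rw [Nat.le_zero, Finset.card_eq_zero] at hc
    exact Finset.notMem_empty j (hc ▸ Finset.mem_filter.2 ⟨Finset.mem_univ _, hj⟩)
  | succ n ih =>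
    obtain ⟨C, hC⟩ := ih
    -- This constant dominates both the new argument C(3i + 2N + 1) of F and the accumulated cost y
    -- + N + C(y + 1).
    refine ⟨(C + 1) * (2 * N + 3), fun F hF hF' i c hc hc0 hci => ?_⟩
    have hFi : F i ≤ F ((C + 1) * (2 * N + 3) * (i + 1)) := hF (by nlinarith [Nat.zero_le (C * N)])
    obtain ⟨g, hg⟩ := Function.ne_iff.1 hc0
    by_cases hgh : ∃ h, g ≠ h ∧ c h ≠ 0
    · obtain ⟨h, hgh, hch⟩ := hgh
      obtain ⟨d, hd, hd0, g', hcg', hdg'⟩ := hN i (F i) c g h hci hgh hg hch (hF' i _ (hci g) hg)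
      have hcard : (Finset.univ.filter fun j => d j ≠ 0).card ≤ n := by
        rw [← Nat.lt_succ_iff]
        refine lt_of_lt_of_le (Finset.card_lt_card ?_) hc
        refine Finset.ssubset_iff_of_subset (fun j hj => ?_) |>.2
          ⟨g', by simpa using hcg', by simpa using hdg'⟩
        simp only [Finset.mem_filter, Finset.mem_univ, true_and] at hj ⊢
        exact fun h0 => hj (apply_eq_zero_of_mem_twistedSpan hd h0)
      -- The new degree is i + 2(min (F i) i + N), at most 3i + 2N.
      obtain ⟨j, hj⟩ := hC F hF hF' (3 * i + 2 * N) d hcard hd0 fun j =>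
        pow_le_pow_right₀ hone (by omega) (apply_mem_pow_of_mem_twistedSpan hGV hd (hci j))
      refine ⟨j, twistedSpan_mono hone ?_ c (twistedSpan_trans hd hj)⟩
      have hF2 : F (C * (3 * i + 2 * N + 1)) ≤ F ((C + 1) * (2 * N + 3) * (i + 1)) := by
        refine hF ?_
        calc C * (3 * i + 2 * N + 1) ≤ (C + 1) * ((2 * N + 3) * (i + 1)) :=
              Nat.mul_le_mul (by omega) (by nlinarith [Nat.zero_le (N * i)])
          _ = _ := by ring
      generalize F ((C + 1) * (2 * N + 3) * (i + 1)) = y at *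
      have h3 : min (F i) i ≤ y := (min_le_left _ _).trans hFi
      calc min (F i) i + N + C * (F (C * (3 * i + 2 * N + 1)) + 1)
          ≤ y + N + C * (y + 1) := by gcongr
        _ ≤ (C + 1) * (2 * N + 3) * (y + 1) := by
          nlinarith [Nat.zero_le (C * N), Nat.zero_le (C * N * y), Nat.zero_le (N * y),
            Nat.zero_le (C * y)]
    · push Not at hgh
      obtain ⟨d, hd, hdg⟩ := exists_mem_twistedSpan_apply_eq hGV c g (hF' i _ (hci g) hg)
      have : d = Pi.single g 1 := by
        ext j
        by_cases hj : g = j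
        · subst hj; simpa using hdg
        · rw [Pi.single_eq_of_ne (Ne.symm hj), apply_eq_zero_of_mem_twistedSpan hd (hgh j hj)]
      refine ⟨g, this ▸ twistedSpan_mono hone (hFi.trans ?_) c hd⟩
      generalize F ((C + 1) * (2 * N + 3) * (i + 1)) = y
      nlinarith [Nat.zero_le (C * N), Nat.zero_le (C * N * y), Nat.zero_le (N * y),
              Nat.zero_le (C * y)]

end Twisted

end FilterDim

namespace FilterDim

/-! ### Growth of return functions under passage to invariants -/

section Invariants

variable {k : Type*} [Field k]

/-- Every nonzero `a ∈ Vⁱ` satisfies `1 ∈ V ^ F(i) a V ^ F(i)`. -/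
def ReturnBound {R : Type*} [Ring R] [Algebra k R] (V : Submodule k R) (F : ℕ → ℕ) : Prop :=
  ∀ i, ∀ a ∈ V ^ i, a ≠ 0 → (1 : R) ∈ V ^ F i * Submodule.span k {a} * V ^ F i

variable {A G : Type*} [Ring A] [Algebra k A] [Group G] [MulSemiringAction G A]
  [SMulCommClass G k A]

theorem mem_mul_of_le {X X' Y Y' : Submodule k A} (hX : X ≤ X') (hY : Y ≤ Y') {z : A}
    (hz : z ∈ X * Y) : z ∈ X' * Y' :=
  (mul_le_mul' hX hY : X * Y ≤ X' * Y') hz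

instance finiteDimensional_mul (X Y : Submodule k A) [FiniteDimensional k X]
    [FiniteDimensional k Y] : FiniteDimensional k (X * Y : Submodule k A) :=
  Module.Finite.iff_fg.2 ((Module.Finite.iff_fg.1 ‹_›).mul (Module.Finite.iff_fg.1 ‹_›))

instance finiteDimensional_pow (X : Submodule k A) [FiniteDimensional k X] (n : ℕ) :
    FiniteDimensional k (X ^ n : Submodule k A) :=
  Module.Finite.iff_fg.2 ((Module.Finite.iff_fg.1 ‹_›).pow n)

theorem one_mem_top_mul_span_mul_top [IsSimpleRing A] {a : A} (ha : a ≠ 0) :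
    (1 : A) ∈ (⊤ : Submodule k A) * Submodule.span k {a} * ⊤ := by
  refine one_mem_of_mul_mem
    ((⊤ : Submodule k A) * Submodule.span k {a} * ⊤).toAddSubgroup (x := a) ?_ ?_ ?_ ha
  · intro b x hx
    rw [Submodule.mem_toAddSubgroup] at hx ⊢
    have := Submodule.mul_mem_mul (Submodule.mem_top (R := k) (x := b)) hx
    rw [← mul_assoc, ← mul_assoc] at this
    exact mem_mul_of_le (mul_le_mul' le_top le_rfl) le_rfl this
  · intro b x hx
    rw [Submodule.mem_toAddSubgroup] at hx ⊢
    have := Submodule.mul_mem_mul hx (Submodule.mem_top (R := k) (x := b))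
    rw [mul_assoc] at this
    exact mem_mul_of_le le_rfl le_top this
  · have := Submodule.mul_mem_mul (Submodule.mul_mem_mul (Submodule.mem_top (R := k) (x := (1 : A)))
      (Submodule.mem_span_singleton_self (R := k) a)) (Submodule.mem_top (R := k) (x := (1 : A)))
    simpa using this

theorem exists_mem_pow_of_adjoin_eq_top {S : Set A} {V : Submodule k A} (h1 : (1 : A) ∈ V)
    (hSV : S ⊆ V) (hS : Algebra.adjoin k S = ⊤) (a : A) : ∃ n, a ∈ V ^ n := by
  have hone : 1 ≤ V := Submodule.one_le.2 h1
  have ha : a ∈ Algebra.adjoin k S := hS ▸ trivial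
  induction ha using Algebra.adjoin_induction with
  | mem x hx =>
    exact ⟨1, by rw [pow_one]; exact hSV hx⟩
  | algebraMap r =>
    exact ⟨1, by
      rw [pow_one, Algebra.algebraMap_eq_smul_one]; exact Submodule.smul_mem _ _ h1⟩
  | add x y _ _ hx hy =>
    obtain ⟨m, hm⟩ := hx
    obtain ⟨n, hn⟩ := hy
    exact ⟨max m n, add_mem (pow_le_pow_right₀ hone (le_max_left _ _) hm)
      (pow_le_pow_right₀ hone (le_max_right _ _) hn)⟩
  | mul x y _ _ hx hy =>
    obtain ⟨m, hm⟩ := hx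
    obtain ⟨n, hn⟩ := hy
    exact ⟨m + n, by rw [pow_add]; exact Submodule.mul_mem_mul hm hn⟩

theorem exists_mem_pow_of_finiteDimensional {V : Submodule k A} (h1 : 1 ≤ V)
    (hV : ∀ a : A, ∃ n, a ∈ V ^ n) (X : Submodule k A) [FiniteDimensional k X] :
    ∃ n, X ≤ V ^ n := by
  obtain ⟨s, hs⟩ := IsNoetherian.noetherian (⊤ : Submodule k X)
  choose f hf using hV
  refine ⟨s.sup fun x => f x, ?_⟩
  have : X = Submodule.span k ((↑) '' (s : Set X)) := by
    rw [← Submodule.coe_subtype, ← Submodule.map_span, hs, Submodule.map_top,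
      Submodule.range_subtype]
  refine this.le.trans (Submodule.span_le.2 ?_)
  rintro _ ⟨x, hx, rfl⟩
  exact pow_le_pow_right₀ h1 (Finset.le_sup (f := fun x : X => f x) hx) (hf x)

/-! ### Orbit sums and a dual basis over the invariants. -/

variable [Fintype G]

/-- The sum over the orbit, `a ↦ ∑ g, g • a`. -/
def orbitSum (k G : Type*) {A : Type*} [Field k] [Ring A] [Algebra k A] [Group G]
    [MulSemiringAction G A] [SMulCommClass G k A] [Fintype G] : A →ₗ[k] A :=
  ∑ g : G, DistribSMul.toLinearMap k A g

theorem orbitSum_apply (a : A) : orbitSum k G a = ∑ g : G, g • a := by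
  simp [orbitSum]

theorem smul_orbitSum (g : G) (a : A) : g • orbitSum k G a = orbitSum k G a := by
  simp only [orbitSum_apply, Finset.smul_sum, smul_smul]
  exact Fintype.sum_equiv (Equiv.mulLeft g) _ _ fun _ => rfl

theorem orbitSum_smul (g : G) (a : A) : orbitSum k G (g • a) = orbitSum k G a := by
  simp only [orbitSum_apply, smul_smul]
  exact Fintype.sum_equiv (Equiv.mulRight g) _ _ fun _ => rfl

theorem orbitSum_mul_of_fixed {b : A} (hb : ∀ g : G, g • b = b) (a : A) :
    orbitSum k G (a * b) = orbitSum k G a * b := by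
  simp [orbitSum_apply, smul_mul', hb, Finset.sum_mul]

theorem orbitSum_mem (a : A) : orbitSum k G a ∈ FixedPoints.subalgebra k A G :=
  fun g => smul_orbitSum g a

theorem map_orbitSum_le (X : Submodule k A) :
    X.map (orbitSum k G) ≤ Subalgebra.toSubmodule (FixedPoints.subalgebra k A G) := by
  rintro _ ⟨a, _, rfl⟩
  exact orbitSum_mem a

theorem one_mem_map_orbitSum [CharZero k] {X : Submodule k A} (h : (1 : A) ∈ X) :
    (1 : A) ∈ X.map (orbitSum k G) := by
  have : (1 : A) = (Fintype.card G : k)⁻¹ • orbitSum k G (1 : A) := by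
    simp only [orbitSum_apply, smul_one, Finset.sum_const, Finset.card_univ]
    rw [← Nat.cast_smul_eq_nsmul k, smul_smul, inv_mul_cancel₀, one_smul]
    exact_mod_cast Fintype.card_ne_zero
  rw [this]
  exact Submodule.smul_mem _ _ (Submodule.mem_map_of_mem h)

/-- A finite dual basis of `A` over the invariants, in terms of subspaces. -/
theorem exists_dual_subspaces [IsSimpleRing A] [IsNoetherianRing A] (hG : ActsByOuter G A) :
    ∃ P Q : Submodule k A, FiniteDimensional k P ∧ FiniteDimensional k Q ∧
      (1 : A) ∈ P ∧ (1 : A) ∈ Q ∧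
      ∀ y : A, y ∈ P * (Q * Submodule.span k {y}).map (orbitSum k G) := by
  classical
  obtain ⟨C, hC⟩ := exists_single_mem_twistedSpan hG (⊤ : Submodule k A) trivial
    (fun a => ⟨1, by simp⟩) (fun _ _ _ => trivial)
  obtain ⟨g, hg⟩ := hC (fun _ => 1) monotone_const
    (fun i a _ ha => by simpa only [pow_one] using one_mem_top_mul_span_mul_top ha) 1 1
    one_ne_zero (fun _ => by simp)
  -- A vector d defines the operator y ↦ ∑ d_h h(y). The image of the constant vector 1 under p ⊗ q
  -- gives y ↦ p tr(q y), whereas the unit vector at g gives y ↦ g(y); comparing the two yields the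
  -- dual basis.
  suffices H : ∀ d ∈ twistedSpan (⊤ : Submodule k A) (C * (1 + 1)) (1 : G → A),
      ∃ P Q : Submodule k A, FiniteDimensional k P ∧ FiniteDimensional k Q ∧
        ∀ y, ∑ h, d h * h • y ∈ P * (Q * Submodule.span k {y}).map (orbitSum k G) by
    obtain ⟨P, Q, hP, hQ, h⟩ := H _ hg
    refine ⟨P ⊔ Submodule.span k {1}, Q.map (DistribSMul.toLinearMap k A g) ⊔ Submodule.span k {1},
      inferInstance, inferInstance,
      Submodule.mem_sup_right (Submodule.mem_span_singleton_self 1),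
      Submodule.mem_sup_right (Submodule.mem_span_singleton_self 1), fun y => ?_⟩
    -- Evaluation at g⁻¹y removes the twist; tr(q g⁻¹(y)) = tr(g(q) y) explains the translate of Q
    -- by g.
    have hy := h (g⁻¹ • y)
    rw [Finset.sum_eq_single g (fun h _ hne => by simp [hne])
      (fun h => absurd (Finset.mem_univ _) h)] at hy
    rw [Pi.single_eq_same, one_mul, smul_inv_smul] at hy
    refine mem_mul_of_le le_sup_left ?_ hy
    rintro _ ⟨z, hz, rfl⟩
    rw [← orbitSum_smul g]
    refine Submodule.mem_map_of_mem ?_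
    refine mem_mul_of_le le_sup_left le_rfl ?_
    induction hz using Submodule.mul_induction_on' with
    | mem_mul_mem q hq t ht =>
      obtain ⟨r, rfl⟩ := Submodule.mem_span_singleton.1 ht
      rw [smul_mul', smul_comm, smul_inv_smul]
      exact Submodule.mul_mem_mul (Submodule.mem_map_of_mem hq)
        (Submodule.smul_mem _ _ (Submodule.mem_span_singleton_self y))
    | add x _ y _ hx hy => rw [smul_add]; exact add_mem hx hy
  intro d hd
  induction hd using Submodule.span_induction with
  | mem d hd =>
    obtain ⟨p, -, q, -, rfl⟩ := hd
    refine ⟨Submodule.span k {p}, Submodule.span k {q}, inferInstance, inferInstance, fun y => ?_⟩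
    have : ∑ h : G, twist k p q 1 h * h • y = p * orbitSum k G (q * y) := by
      simp [orbitSum_apply, Finset.mul_sum, mul_assoc]
    rw [this]
    exact Submodule.mul_mem_mul (Submodule.mem_span_singleton_self p) (Submodule.mem_map_of_mem
      (Submodule.mul_mem_mul (Submodule.mem_span_singleton_self q)
        (Submodule.mem_span_singleton_self y)))
  | zero => exact ⟨⊥, ⊥, inferInstance, inferInstance, fun y => by simp⟩
  | add d d' _ _ hd hd' =>
    obtain ⟨P, Q, hP, hQ, h⟩ := hd
    obtain ⟨P', Q', hP', hQ', h'⟩ := hd'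
    refine ⟨P ⊔ P', Q ⊔ Q', inferInstance, inferInstance, fun y => ?_⟩
    simp only [Pi.add_apply, add_mul, Finset.sum_add_distrib]
    exact add_mem
      (mem_mul_of_le le_sup_left
        (Submodule.map_mono (mul_le_mul' le_sup_left le_rfl)) (h y))
      (mem_mul_of_le le_sup_right
        (Submodule.map_mono (mul_le_mul' le_sup_right le_rfl)) (h' y))
  | smul t d _ hd =>
    obtain ⟨P, Q, hP, hQ, h⟩ := hd
    refine ⟨P, Q, hP, hQ, fun y => ?_⟩
    simp only [Pi.smul_apply, smul_mul_assoc, ← Finset.smul_sum]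
    exact Submodule.smul_mem _ _ (h y)

/-! ### Comparing powers of a frame of `A` with powers of a frame of the invariants. -/

section Transfer

variable {P Q : Submodule k A} (V : Submodule k A)

/-- The subspace of the invariants attached to a frame `V` and a pair of dual subspaces. -/
def invariantFrame (G : Type*) [Group G] [MulSemiringAction G A] [SMulCommClass G k A] [Fintype G]
    (P Q V : Submodule k A) : Submodule k A :=
  (Q * V * P).map (orbitSum k G)

theorem invariantFrame_le :
    invariantFrame G P Q V ≤ Subalgebra.toSubmodule (FixedPoints.subalgebra k A G) :=
  map_orbitSum_le _

theorem one_le_invariantFrame [CharZero k] (hP : (1 : A) ∈ P) (hQ : (1 : A) ∈ Q)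
    (hV : (1 : A) ∈ V) : 1 ≤ invariantFrame G P Q V :=
  Submodule.one_le.2 (one_mem_map_orbitSum (by
    simpa using Submodule.mul_mem_mul (Submodule.mul_mem_mul hQ hV) hP))

theorem smul_eq_of_mem_invariantFrame_pow {n : ℕ} {d : A} (hd : d ∈ invariantFrame G P Q V ^ n)
    (g : G) : g • d = d := by
  have : ∀ m, invariantFrame G P Q V ^ m ≤
      Subalgebra.toSubmodule (FixedPoints.subalgebra k A G) := by
    intro m
    induction m with
    | zero => rw [pow_zero, Submodule.one_le]; exact one_mem (FixedPoints.subalgebra k A G)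
    | succ m ih =>
      rw [pow_succ]
      exact Submodule.mul_le.2 fun x hx y hy =>
        (FixedPoints.subalgebra k A G).mul_mem (ih hx) (invariantFrame_le V hy)
  exact this n hd g

/-- The dual basis expands v p as a combination of elements of P with coefficients in tr(Q V P).
Thus P absorbs each factor V from the left at the price of one factor of the frame on the right. -/
theorem pow_mul_le_mul_invariantFrame_pow
    (hPQ : ∀ y : A, y ∈ P * (Q * Submodule.span k {y}).map (orbitSum k G)) (m : ℕ) :
    V ^ m * P ≤ P * invariantFrame G P Q V ^ m := by
  induction m with
  | zero => simp
  | succ m ih =>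
    have hVP : V * P ≤ P * invariantFrame G P Q V := by
      refine Submodule.mul_le.2 fun v hv p hp => ?_
      refine mul_le_mul' le_rfl (Submodule.map_mono ?_) (hPQ (v * p))
      rw [mul_assoc]
      refine mul_le_mul' le_rfl ?_
      rw [Submodule.span_singleton_le_iff_mem]
      exact Submodule.mul_mem_mul hv hp
    calc V ^ (m + 1) * P = V * (V ^ m * P) := by rw [pow_succ', mul_assoc]
      _ ≤ V * (P * invariantFrame G P Q V ^ m) := mul_le_mul' le_rfl ih
      _ = (V * P) * invariantFrame G P Q V ^ m := by rw [mul_assoc]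
      _ ≤ P * invariantFrame G P Q V * invariantFrame G P Q V ^ m :=
        mul_le_mul' hVP le_rfl
      _ = P * invariantFrame G P Q V ^ (m + 1) := by rw [pow_succ', mul_assoc]

/-- Write a in P Dᵐ, where D is the invariant frame. The orbit sum is D-linear and maps P into D,
which accounts for the extra power. -/
theorem orbitSum_mem_invariantFrame_pow
    (hP : (1 : A) ∈ P) (hQ : (1 : A) ∈ Q) (hV : (1 : A) ∈ V)
    (hPQ : ∀ y : A, y ∈ P * (Q * Submodule.span k {y}).map (orbitSum k G)) {m : ℕ} {a : A}
    (ha : a ∈ V ^ m) : orbitSum k G a ∈ invariantFrame G P Q V ^ (m + 1) := by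
  have ha' : a ∈ P * invariantFrame G P Q V ^ m :=
    pow_mul_le_mul_invariantFrame_pow V hPQ m (by simpa using Submodule.mul_mem_mul ha hP)
  clear ha
  induction ha' using Submodule.mul_induction_on' with
  | mem_mul_mem p hp d hd =>
    rw [orbitSum_mul_of_fixed (smul_eq_of_mem_invariantFrame_pow V hd), pow_succ']
    refine Submodule.mul_mem_mul (Submodule.mem_map_of_mem ?_) hd
    simpa using Submodule.mul_mem_mul (Submodule.mul_mem_mul hQ hV) hp
  | add x _ y _ hx hy => rw [map_add]; exact add_mem hx hy

theorem mem_invariantFrame_pow [CharZero k]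
    (hP : (1 : A) ∈ P) (hQ : (1 : A) ∈ Q) (hV : (1 : A) ∈ V)
    (hPQ : ∀ y : A, y ∈ P * (Q * Submodule.span k {y}).map (orbitSum k G)) {m : ℕ} {b : A}
    (hb : b ∈ V ^ m) (hbG : ∀ g : G, g • b = b) : b ∈ invariantFrame G P Q V ^ (m + 1) := by
  have h := orbitSum_mem_invariantFrame_pow V hP hQ hV hPQ hb
  have h1 : orbitSum k G b = (Fintype.card G : k) • b := by
    simp [orbitSum_apply, hbG, Nat.cast_smul_eq_nsmul]
  rw [h1] at h
  have h2 : (Fintype.card G : k) ≠ 0 := by exact_mod_cast Fintype.card_ne_zero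
  simpa [smul_smul, inv_mul_cancel₀ h2] using
    Submodule.smul_mem _ (Fintype.card G : k)⁻¹ h

/-- Summing the coordinates of the vector p b h(q) gives p b tr(q), and a further orbit sum gives
tr(p) b tr(q). The same operations send the unit vector to |G|, which is invertible in
characteristic 0. -/
theorem one_mem_of_single_mem_twistedSpan [CharZero k] [DecidableEq G]
    (hP : (1 : A) ∈ P) (hQ : (1 : A) ∈ Q) (hV : (1 : A) ∈ V)
    (hPQ : ∀ y : A, y ∈ P * (Q * Submodule.span k {y}).map (orbitSum k G)) {m : ℕ} {b : A}
    (hb : ∀ g : G, g • b = b) {g : G}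
    (hg : (Pi.single g 1 : G → A) ∈ twistedSpan V m fun _ => b) :
    (1 : A) ∈ invariantFrame G P Q V ^ (m + 1) * Submodule.span k {b} *
      invariantFrame G P Q V ^ (m + 1) := by
  suffices H : twistedSpan V m (fun _ : G => b) ≤
      (invariantFrame G P Q V ^ (m + 1) * Submodule.span k {b} *
        invariantFrame G P Q V ^ (m + 1)).comap
        (orbitSum k G ∘ₗ ∑ h : G, LinearMap.proj (R := k) (φ := fun _ : G => A) h) by
    have h := H hg
    simp only [Submodule.mem_comap, LinearMap.coe_comp, Function.comp_apply,
      LinearMap.coe_sum, Finset.sum_apply, LinearMap.proj_apply,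
      Finset.sum_pi_single', Finset.mem_univ, if_true] at h
    have h2 : orbitSum k G (1 : A) = (Fintype.card G : k) • (1 : A) := by
      simp [orbitSum_apply, Nat.cast_smul_eq_nsmul]
    rw [h2] at h
    have h3 : (Fintype.card G : k) ≠ 0 := by exact_mod_cast Fintype.card_ne_zero
    simpa only [smul_smul, inv_mul_cancel₀ h3, one_smul] using
      Submodule.smul_mem _ (Fintype.card G : k)⁻¹ h
  refine Submodule.span_le.2 ?_
  rintro _ ⟨p, hp, q, hq, rfl⟩
  have h1 : ∑ x : G, twist k p q (fun _ : G => b) x = p * (b * orbitSum k G q) := by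
    simp [orbitSum_apply, Finset.mul_sum, mul_assoc]
  simp only [Submodule.comap_coe, Set.mem_preimage, SetLike.mem_coe, LinearMap.coe_comp,
    Function.comp_apply, LinearMap.coe_sum, Finset.sum_apply, LinearMap.proj_apply, h1]
  rw [orbitSum_mul_of_fixed (fun g => by rw [smul_mul', hb, smul_orbitSum]), ← mul_assoc]
  exact Submodule.mul_mem_mul (Submodule.mul_mem_mul
    (orbitSum_mem_invariantFrame_pow V hP hQ hV hPQ hp) (Submodule.mem_span_singleton_self b))
    (orbitSum_mem_invariantFrame_pow V hP hQ hV hPQ hq)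

end Transfer

/-! ### Restriction to the subalgebra of invariants. -/

theorem map_val_comap_val (B : Subalgebra k A) {D : Submodule k A}
    (hD : D ≤ Subalgebra.toSubmodule B) :
    (D.comap B.val.toLinearMap).map B.val.toLinearMap = D := by
  refine Submodule.map_comap_eq_self fun x hx => ⟨⟨x, hD hx⟩, rfl⟩

theorem mem_comap_val_pow (B : Subalgebra k A) {D : Submodule k A}
    (hD : D ≤ Subalgebra.toSubmodule B) (n : ℕ) (b : B) :
    b ∈ (D.comap B.val.toLinearMap) ^ n ↔ (b : A) ∈ D ^ n := by
  have h := Submodule.map_pow (D.comap B.val.toLinearMap) B.val n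
  rw [map_val_comap_val B hD] at h
  rw [← h]
  constructor
  · exact fun hb => Submodule.mem_map_of_mem hb
  · rintro ⟨x, hx, hxb⟩
    rwa [← Subtype.ext hxb]

theorem one_mem_comap_val (B : Subalgebra k A) {D : Submodule k A}
    (hD : D ≤ Subalgebra.toSubmodule B) (n : ℕ) (b : B)
    (h : (1 : A) ∈ D ^ n * Submodule.span k {(b : A)} * D ^ n) :
    (1 : B) ∈ (D.comap B.val.toLinearMap) ^ n * Submodule.span k {b} *
      (D.comap B.val.toLinearMap) ^ n := by
  have h' : ((D.comap B.val.toLinearMap) ^ n * Submodule.span k {b} *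
      (D.comap B.val.toLinearMap) ^ n).map B.val.toLinearMap =
        D ^ n * Submodule.span k {(b : A)} * D ^ n := by
    rw [Submodule.map_mul, Submodule.map_mul, Submodule.map_pow, map_val_comap_val B hD,
      Submodule.map_span, Set.image_singleton]
    rfl
  rw [← h'] at h
  obtain ⟨x, hx, hx1⟩ := h
  rwa [← (Subtype.ext hx1 : x = 1)]

/-- The invariants of a simple noetherian algebra under outer automorphisms form a simple
algebra. -/
theorem fixedPoints_one_mem [CharZero k] [IsSimpleRing A] [IsNoetherianRing A]
    (hG : ActsByOuter G A) (b : FixedPoints.subalgebra k A G) (hb : b ≠ 0) :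
    1 ∈ (⊤ : Submodule k (FixedPoints.subalgebra k A G)) * Submodule.span k {b} * ⊤ := by
  classical
  obtain ⟨P, Q, -, -, hP, hQ, hPQ⟩ := exists_dual_subspaces (k := k) hG
  -- The full space serves as V with constant return bound 1: only the qualitative statement is
  -- needed.
  obtain ⟨C, hC⟩ := exists_single_mem_twistedSpan hG (⊤ : Submodule k A) trivial
    (fun a => ⟨1, by simp⟩) (fun _ _ _ => trivial)
  obtain ⟨g, hg⟩ := hC (fun _ => 1) monotone_const
    (fun i a _ ha => by simpa only [pow_one] using one_mem_top_mul_span_mul_top ha) 1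
    (fun _ => (b : A)) (fun h => hb (Subtype.ext (congrFun h 1))) (fun _ => by simp)
  have := one_mem_comap_val (FixedPoints.subalgebra k A G) (invariantFrame_le ⊤) _ b
    (one_mem_of_single_mem_twistedSpan ⊤ hP hQ trivial hPQ b.2 hg)
  exact mem_mul_of_le (mul_le_mul' le_top le_rfl) le_top this

/-- A finite-dimensional frame of a finitely generated algebra which is stable under a finite
group and generates the algebra. -/
theorem exists_stable_frame [Algebra.FiniteType k A] :
    ∃ V : Submodule k A, FiniteDimensional k V ∧ (1 : A) ∈ V ∧ (∀ a : A, ∃ n, a ∈ V ^ n) ∧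
      ∀ g : G, ∀ x ∈ V, g • x ∈ V := by
  obtain ⟨S, hS⟩ := (Algebra.FiniteType.out : (⊤ : Subalgebra k A).FG)
  have hfin : FiniteDimensional k (Submodule.span k (insert 1 (S : Set A))) :=
    FiniteDimensional.span_of_finite k (S.finite_toSet.insert 1)
  let V : Submodule k A := ⨆ g : G,
    (Submodule.span k (insert 1 (S : Set A))).map (DistribSMul.toLinearMap k A g)
  have hle : Submodule.span k (insert 1 (S : Set A)) ≤ V := by
    refine le_trans ?_ (le_iSup _ (1 : G))
    intro x hx
    exact ⟨x, hx, one_smul G x⟩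
  have h1 : (1 : A) ∈ V := hle (Submodule.subset_span (Set.mem_insert _ _))
  refine ⟨V, inferInstance, h1, fun a => ?_, fun g x hx => ?_⟩
  · exact exists_mem_pow_of_adjoin_eq_top h1 ((Set.subset_insert _ _).trans
      (Submodule.subset_span.trans hle)) hS a
  · suffices H : V ≤ V.comap (DistribSMul.toLinearMap k A g) from H hx
    refine iSup_le fun h => ?_
    rintro _ ⟨x, hx, rfl⟩
    refine Submodule.mem_iSup_of_mem (g * h) ⟨x, hx, ?_⟩
    simp [mul_smul]

/-- If D ⊆ Vᵉ, an invariant b in Dⁱ lies in Vᵉⁱ. Separation of the constant vector b followed by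
orbit sums changes F only by affine substitutions inside and outside. -/
theorem exists_invariant_frame [CharZero k] [IsSimpleRing A] [IsNoetherianRing A]
    (hG : ActsByOuter G A) (V : Submodule k A) [FiniteDimensional k V] (h1 : (1 : A) ∈ V)
    (hV : ∀ a : A, ∃ n, a ∈ V ^ n) (hGV : ∀ g : G, ∀ x ∈ V, g • x ∈ V) :
    ∃ D : Submodule k (FixedPoints.subalgebra k A G), FiniteDimensional k D ∧ 1 ∈ D ∧
      (∀ b, ∃ n, b ∈ D ^ n) ∧
      ∃ C : ℕ, ∀ F : ℕ → ℕ, Monotone F → ReturnBound V F →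
        ReturnBound D fun i => C * (F (C * (i + 1)) + 1) := by
  classical
  have hone : 1 ≤ V := Submodule.one_le.2 h1
  obtain ⟨P, Q, _, _, hP, hQ, hPQ⟩ := exists_dual_subspaces (k := k) hG
  obtain ⟨C, hC⟩ := exists_single_mem_twistedSpan hG V h1 hV hGV
  have hDfin : FiniteDimensional k (invariantFrame G P Q V) := by
    have : FiniteDimensional k (Q * V * P : Submodule k A) := inferInstance
    unfold invariantFrame
    infer_instance
  have hDB := invariantFrame_le (G := G) (P := P) (Q := Q) V
  obtain ⟨e, he⟩ := exists_mem_pow_of_finiteDimensional hone hV (invariantFrame G P Q V)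
  have hD1 := one_le_invariantFrame (G := G) (P := P) (Q := Q) V hP hQ h1
  refine ⟨(invariantFrame G P Q V).comap (FixedPoints.subalgebra k A G).val.toLinearMap, ?_,
    (Submodule.one_le (R := k) (A := A)).1 hD1, fun b => ?_, (C + 1) * (e + 1), fun F hF hFV i b hb hb0 => ?_⟩
  · refine FiniteDimensional.of_injective
      ((FixedPoints.subalgebra k A G).val.toLinearMap.restrict
        (p := (invariantFrame G P Q V).comap (FixedPoints.subalgebra k A G).val.toLinearMap)
        (q := invariantFrame G P Q V) fun x hx => hx) ?_
    intro x y hxy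
    exact Subtype.ext (Subtype.ext (congrArg (fun z : invariantFrame G P Q V => (z : A)) hxy))
  · obtain ⟨n, hn⟩ := hV b
    exact ⟨n + 1, (mem_comap_val_pow _ hDB _ b).2
      (mem_invariantFrame_pow V hP hQ h1 hPQ hn b.2)⟩
  · have hbV : (b : A) ∈ V ^ (e * i) := by
      rw [pow_mul]
      exact pow_le_pow_left' he i ((mem_comap_val_pow _ hDB _ b).1 hb)
    obtain ⟨g, hg⟩ := hC F hF hFV (e * i) (fun _ => (b : A))
      (fun h => hb0 (Subtype.ext (congrFun h 1))) fun _ => hbV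
    refine one_mem_comap_val _ hDB _ b ?_
    have h := one_mem_of_single_mem_twistedSpan V hP hQ h1 hPQ b.2 hg
    have hle : C * (F (C * (e * i + 1)) + 1) + 1 ≤
        (C + 1) * (e + 1) * (F ((C + 1) * (e + 1) * (i + 1)) + 1) := by
      have : F (C * (e * i + 1)) ≤ F ((C + 1) * (e + 1) * (i + 1)) := by
        refine hF ?_
        rw [mul_assoc]
        exact Nat.mul_le_mul (by omega) (by nlinarith)
      generalize F ((C + 1) * (e + 1) * (i + 1)) = y at *
      generalize F (C * (e * i + 1)) = x at *
      calc C * (x + 1) + 1 ≤ (C + 1) * (y + 1) := by nlinarith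
        _ ≤ (C + 1) * (e + 1) * (y + 1) := by
          refine Nat.mul_le_mul_right _ ?_
          nlinarith
    have hpow := pow_le_pow_right₀ hD1 hle
    exact mul_le_mul' (mul_le_mul' hpow le_rfl) hpow h

/-- The dual basis shows that P spans A as a right module over the invariants. -/
theorem finiteDimensional_of_fixedPoints [IsSimpleRing A] [IsNoetherianRing A]
    (hG : ActsByOuter G A) [FiniteDimensional k (FixedPoints.subalgebra k A G)] :
    FiniteDimensional k A := by
  obtain ⟨P, Q, _, _, hP, hQ, hPQ⟩ := exists_dual_subspaces (k := k) hG
  have : FiniteDimensional k (Subalgebra.toSubmodule (FixedPoints.subalgebra k A G)) := ‹_›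
  have hfin : FiniteDimensional k
      (P * Subalgebra.toSubmodule (FixedPoints.subalgebra k A G) : Submodule k A) := inferInstance
  have htop : P * Subalgebra.toSubmodule (FixedPoints.subalgebra k A G) = ⊤ :=
    eq_top_iff.2 fun y _ => mul_le_mul' le_rfl (map_orbitSum_le _) (hPQ y)
  rw [htop] at hfin
  exact Module.finite_def.2 ((Submodule.fg_top _).1 (Module.finite_def.1 hfin))

end Invariants

end FilterDim

namespace FilterDim

/-! ### The filter dimension in terms of frames -/

section ActOn

variable {k A M : Type*} [Field k] [Ring A] [Algebra k A] [AddCommGroup M] [Module k M]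
  [Module A M]

theorem smul_mem_actOn {V : Submodule k A} {F : Submodule k M} {v : A} {m : M} (hv : v ∈ V)
    (hm : m ∈ F) : v • m ∈ actOn k V F :=
  Submodule.subset_span ⟨v, hv, m, hm, rfl⟩

theorem actOn_le {V : Submodule k A} {F X : Submodule k M} :
    actOn k V F ≤ X ↔ ∀ v ∈ V, ∀ m ∈ F, v • m ∈ X := by
  refine ⟨fun h v hv m hm => h (smul_mem_actOn hv hm), fun h => Submodule.span_le.2 ?_⟩
  rintro _ ⟨v, hv, m, hm, rfl⟩
  exact h v hv m hm

theorem actOn_mono {V V' : Submodule k A} {F F' : Submodule k M} (hV : V ≤ V') (hF : F ≤ F') :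
    actOn k V F ≤ actOn k V' F' :=
  actOn_le.2 fun _ hv _ hm => smul_mem_actOn (hV hv) (hF hm)

theorem le_actOn {V : Submodule k A} (hV : 1 ≤ V) (F : Submodule k M) : F ≤ actOn k V F :=
  fun m hm => by simpa using smul_mem_actOn (Submodule.one_le.1 hV) hm

theorem smul_mem_actOn_mul [IsScalarTower k A M] {V V' : Submodule k A} {F : Submodule k M}
    {v : A} {m : M} (hv : v ∈ V) (hm : m ∈ actOn k V' F) : v • m ∈ actOn k (V * V') F := by
  have := IsScalarTower.to_smulCommClass (R := k) (A := A) (M := M)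
  induction hm using Submodule.span_induction with
  | mem x hx =>
    obtain ⟨w, hw, m, hm, rfl⟩ := hx
    rw [smul_smul]
    exact smul_mem_actOn (Submodule.mul_mem_mul hv hw) hm
  | zero => rw [smul_zero]; exact zero_mem _
  | add x y _ _ hx hy => rw [smul_add]; exact add_mem hx hy
  | smul t x _ hx => rw [← smul_comm]; exact Submodule.smul_mem _ _ hx

theorem exists_mem_actOn_pow [IsScalarTower k A M] {V : Submodule k A} (h1 : 1 ≤ V)
    (hV : ∀ a : A, ∃ n, a ∈ V ^ n) (F : Submodule k M) {x : M}
    (hx : x ∈ Submodule.span A (F : Set M)) : ∃ n, x ∈ actOn k (V ^ n) F := by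
  induction hx using Submodule.span_induction with
  | mem x hx => exact ⟨0, le_actOn (by rw [pow_zero]) F hx⟩
  | zero => exact ⟨0, zero_mem _⟩
  | add x y _ _ hx hy =>
    obtain ⟨m, hm⟩ := hx
    obtain ⟨n, hn⟩ := hy
    exact ⟨max m n, add_mem
      (actOn_mono (pow_le_pow_right₀ h1 (le_max_left _ _)) le_rfl hm)
      (actOn_mono (pow_le_pow_right₀ h1 (le_max_right _ _)) le_rfl hn)⟩
  | smul a x _ hx =>
    obtain ⟨m, hm⟩ := hx
    obtain ⟨n, hn⟩ := hV a
    exact ⟨n + m, by rw [pow_add]; exact smul_mem_actOn_mul hn hm⟩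

theorem one_le_span_insert_one (S : Set A) : 1 ≤ Submodule.span k (insert 1 S) :=
  Submodule.one_le.2 (Submodule.subset_span (Set.mem_insert _ _))

theorem exists_le_of_returnFunction_le {S : Finset A} {M₀ : Submodule k M} {i : ℕ} {x : ℝ}
    (hx : 0 ≤ x)
    (h : ((returnFunction k S M₀ i : ℕ∞) : ENNReal) ≤ ENNReal.ofReal x) :
    ∃ j ≤ ⌊x⌋₊, ∀ W : Submodule k M, FiniteDimensional k W →
      W ≤ actOn k (stdFiltration k S i) M₀ → Submodule.span A (W : Set M) = ⊤ →
      M₀ ≤ actOn k (stdFiltration k S j) W := by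
  have h1 : returnFunction k S M₀ i < ((⌊x⌋₊ + 1 : ℕ) : ℕ∞) := by
    by_contra! hc
    have h2 : (((⌊x⌋₊ + 1 : ℕ) : ℕ∞) : ENNReal) ≤ ENNReal.ofReal x :=
      (ENat.toENNReal_le.2 hc).trans h
    rw [ENat.toENNReal_coe, ENNReal.le_ofReal_iff_toReal_le (ENNReal.natCast_ne_top _) hx,
      ENNReal.toReal_natCast] at h2
    exact absurd (Nat.lt_floor_add_one x) (not_lt.2 (by exact_mod_cast h2))
  simp only [returnFunction, iInf_lt_iff] at h1
  obtain ⟨j, hj, hlt⟩ := h1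
  exact ⟨j, by exact Nat.lt_succ_iff.1 (by exact_mod_cast hlt), hj⟩

theorem returnFunction_le {S : Finset A} {M₀ : Submodule k M} {i j : ℕ}
    (h : ∀ W : Submodule k M, FiniteDimensional k W →
      W ≤ actOn k (stdFiltration k S i) M₀ → Submodule.span A (W : Set M) = ⊤ →
      M₀ ≤ actOn k (stdFiltration k S j) W) : returnFunction k S M₀ i ≤ j :=
  iInf₂_le j h

theorem gammaExp_le {f : ℕ → ℕ∞} {r : ℝ}
    (h : ∀ᶠ i : ℕ in Filter.atTop, ∃ j : ℕ, f i ≤ j ∧ (j : ℝ) ≤ (i : ℝ) ^ r) :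
    gammaExp f ≤ r := by
  refine iInf₂_le r ?_
  filter_upwards [h] with i hi
  obtain ⟨j, hj, hjr⟩ := hi
  refine (ENat.toENNReal_le.2 hj).trans ?_
  rw [ENat.toENNReal_coe, ENNReal.le_ofReal_iff_toReal_le (ENNReal.natCast_ne_top _)
    (by positivity), ENNReal.toReal_natCast]
  exact hjr

end ActOn

/-! ### Filter dimension and quantitative simplicity. -/

section Sandwich

/-- An algebra `E` spanned by elements `p ⊗ q`, `p, q ∈ R`, which acts on `R` by
`(p ⊗ q) • x = p x q`. -/
structure SandwichAction (k R E : Type*) [Field k] [Ring R] [Algebra k R] [Ring E] [Algebra k E]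
    [Module E R] where
  /-- The elements `p ⊗ q`. -/
  tmul : R →ₗ[k] R →ₗ[k] E
  tmul_smul : ∀ p q x, tmul p q • x = p * x * q
  tmul_mul_tmul : ∀ p q p' q', tmul p q * tmul p' q' = tmul (p * p') (q' * q)
  tmul_one_one : tmul 1 1 = 1
  span_eq_top : Submodule.span k {t | ∃ p q, t = tmul p q} = ⊤

variable {k R E : Type*} [Field k] [Ring R] [Algebra k R] [Ring E] [Algebra k E] [Module E R]
  (T : SandwichAction k R E)

theorem SandwichAction.tmul_left_mem_pow {V : Submodule k R} {n : ℕ} {p : R} (hp : p ∈ V ^ n) :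
    T.tmul p 1 ∈ (V.map (T.tmul.flip 1)) ^ n := by
  induction hp using Submodule.pow_induction_on_left' with
  | algebraMap c =>
    rw [Algebra.algebraMap_eq_smul_one, map_smul, LinearMap.smul_apply, T.tmul_one_one, pow_zero]
    exact Submodule.smul_mem _ _ (Submodule.one_le.1 le_rfl)
  | add x y i _ _ hx hy => rw [map_add, LinearMap.add_apply]; exact add_mem hx hy
  | mem_mul v hv i x _ hx =>
    have : T.tmul (v * x) 1 = T.tmul v 1 * T.tmul x 1 := by rw [T.tmul_mul_tmul, mul_one]
    rw [this, pow_succ']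
    exact Submodule.mul_mem_mul (Submodule.mem_map_of_mem (f := T.tmul.flip 1) hv) hx

theorem SandwichAction.tmul_right_mem_pow {V : Submodule k R} {n : ℕ} {p : R} (hp : p ∈ V ^ n) :
    T.tmul 1 p ∈ (V.map (T.tmul 1)) ^ n := by
  induction hp using Submodule.pow_induction_on_left' with
  | algebraMap c =>
    rw [Algebra.algebraMap_eq_smul_one, map_smul, T.tmul_one_one, pow_zero]
    exact Submodule.smul_mem _ _ (Submodule.one_le.1 le_rfl)
  | add x y i _ _ hx hy => rw [map_add]; exact add_mem hx hy
  | mem_mul v hv i x _ hx =>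
    have : T.tmul 1 (v * x) = T.tmul 1 x * T.tmul 1 v := by rw [T.tmul_mul_tmul, mul_one]
    rw [this, pow_succ]
    exact Submodule.mul_mem_mul hx (Submodule.mem_map_of_mem hv)

/-- The span of the tensors `p ⊗ q` with `p, q ∈ Vᵐ`. -/
def sandwich (V : Submodule k R) (m : ℕ) : Submodule k E :=
  Submodule.span k {t | ∃ p ∈ V ^ m, ∃ q ∈ V ^ m, t = T.tmul p q}

theorem tmul_mem_sandwich {V : Submodule k R} {m : ℕ} {p q : R} (hp : p ∈ V ^ m)
    (hq : q ∈ V ^ m) : T.tmul p q ∈ sandwich T V m :=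
  Submodule.subset_span ⟨p, hp, q, hq, rfl⟩

theorem sandwich_mono {V : Submodule k R} (h1 : 1 ≤ V) {m n : ℕ} (hmn : m ≤ n) :
    sandwich T V m ≤ sandwich T V n := by
  refine Submodule.span_mono ?_
  rintro _ ⟨p, hp, q, hq, rfl⟩
  exact ⟨p, pow_le_pow_right₀ h1 hmn hp, q, pow_le_pow_right₀ h1 hmn hq, rfl⟩

theorem sandwich_mul_le (V : Submodule k R) (m n : ℕ) :
    sandwich T V m * sandwich T V n ≤ sandwich T V (m + n) := by
  rw [sandwich, sandwich, Submodule.span_mul_span]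
  refine Submodule.span_le.2 ?_
  rintro _ ⟨_, ⟨p, hp, q, hq, rfl⟩, _, ⟨p', hp', q', hq', rfl⟩, rfl⟩
  simp only [T.tmul_mul_tmul]
  refine tmul_mem_sandwich T ?_ ?_
  · rw [pow_add]; exact Submodule.mul_mem_mul hp hp'
  · rw [add_comm, pow_add]; exact Submodule.mul_mem_mul hq' hq

theorem sandwich_pow_le (V : Submodule k R) (m n : ℕ) :
    sandwich T V m ^ n ≤ sandwich T V (m * n) := by
  induction n with
  | zero =>
    rw [pow_zero, Submodule.one_le, ← T.tmul_one_one]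
    exact tmul_mem_sandwich T (by simp [Submodule.one_le.1 le_rfl])
      (by simp [Submodule.one_le.1 le_rfl])
  | succ n ih =>
    rw [pow_succ]
    exact (mul_le_mul' ih le_rfl).trans (sandwich_mul_le T V _ _)

theorem exists_mem_sandwich {V : Submodule k R} (h1 : 1 ≤ V) (hV : ∀ a : R, ∃ n, a ∈ V ^ n)
    (t : E) : ∃ n, t ∈ sandwich T V n := by
  have ht : t ∈ Submodule.span k {t | ∃ p q, t = T.tmul p q} := T.span_eq_top ▸ trivial
  induction ht using Submodule.span_induction with
  | mem t ht =>
    obtain ⟨p, q, rfl⟩ := ht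
    obtain ⟨m, hm⟩ := hV p
    obtain ⟨n, hn⟩ := hV q
    exact ⟨max m n, tmul_mem_sandwich T (pow_le_pow_right₀ h1 (le_max_left _ _) hm)
      (pow_le_pow_right₀ h1 (le_max_right _ _) hn)⟩
  | zero => exact ⟨0, zero_mem _⟩
  | add s t _ _ hs ht =>
    obtain ⟨m, hm⟩ := hs
    obtain ⟨n, hn⟩ := ht
    exact ⟨max m n, add_mem (sandwich_mono T h1 (le_max_left _ _) hm)
      (sandwich_mono T h1 (le_max_right _ _) hn)⟩
  | smul c t _ ht =>
    obtain ⟨n, hn⟩ := ht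
    exact ⟨n, Submodule.smul_mem _ _ hn⟩

theorem exists_stdFiltration_le_sandwich {V : Submodule k R} (h1 : 1 ≤ V)
    (hV : ∀ a : R, ∃ n, a ∈ V ^ n) (S : Finset E) :
    ∃ s, ∀ j, stdFiltration k S j ≤ sandwich T V (s * j) := by
  choose f hf using exists_mem_sandwich T h1 hV
  refine ⟨S.sup f, fun j => (pow_le_pow_left' ?_ j).trans (sandwich_pow_le T V _ j)⟩
  refine Submodule.span_le.2 (Set.insert_subset ?_ fun t ht => ?_)
  · rw [← T.tmul_one_one]
    exact tmul_mem_sandwich T (Submodule.one_le.1 (one_le_pow₀ h1))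
      (Submodule.one_le.1 (one_le_pow₀ h1))
  · exact sandwich_mono T h1 (Finset.le_sup ht) (hf t)

include T in
theorem moduleFilterDim_eq_bot [Nontrivial R] (h : ∀ a : R, a ∈ Submodule.span k {(1 : R)}) :
    moduleFilterDim k E R = ⊥ := by
  have hgen : Algebra.adjoin k ((∅ : Finset E) : Set E) = ⊤ := by
    refine eq_top_iff.2 ?_
    rintro t -
    have ht : t ∈ Submodule.span k {t | ∃ p q, t = T.tmul p q} := T.span_eq_top ▸ trivial
    induction ht using Submodule.span_induction with
    | mem t ht =>
      obtain ⟨p, q, rfl⟩ := ht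
      obtain ⟨c, rfl⟩ := Submodule.mem_span_singleton.1 (h p)
      obtain ⟨d, rfl⟩ := Submodule.mem_span_singleton.1 (h q)
      rw [map_smul, map_smul, LinearMap.smul_apply, T.tmul_one_one]
      exact Subalgebra.smul_mem _ (Subalgebra.smul_mem _ (one_mem _) c) d
    | zero => exact zero_mem _
    | add s t _ _ hs ht => exact add_mem hs ht
    | smul c t _ ht => exact Subalgebra.smul_mem _ ht c
  have hspan : Submodule.span E ((Submodule.span k {(1 : R)} : Submodule k R) : Set R)
      = ⊤ := eq_top_iff.2 fun y _ => Submodule.subset_span (h y)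
  refine le_bot_iff.1 (le_of_forall_gt fun c hc => ?_)
  obtain ⟨r, -, hr⟩ := EReal.lt_iff_exists_real_btwn.1 hc
  refine lt_of_le_of_lt ?_ hr
  refine le_trans (iInf_le_of_le ∅ (iInf_le_of_le hgen (iInf_le_of_le (Submodule.span k {1})
    (iInf_le_of_le inferInstance (iInf_le _ hspan))))) (gammaExp_le ?_)
  -- A nonzero W is already the whole line, so the return function is 0 and satisfies the bound for
  -- every real exponent, including negative ones.
  refine Filter.Eventually.of_forall fun i => ⟨0, returnFunction_le fun W _ hW hWspan => ?_, by
    rw [Nat.cast_zero]; positivity⟩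
  obtain ⟨w, hw, hw0⟩ : ∃ w ∈ W, w ≠ 0 := by
    by_contra! h
    have h' : Submodule.span E (W : Set R) = ⊥ := by
      rw [Submodule.span_eq_bot]; exact fun x hx => h x hx
    exact bot_ne_top (h'.symm.trans hWspan)
  obtain ⟨c, rfl⟩ := Submodule.mem_span_singleton.1 (h w)
  have hc0 : c ≠ 0 := by rintro rfl; exact hw0 (zero_smul _ _)
  rw [Submodule.span_singleton_le_iff_mem]
  refine le_actOn (by rw [stdFiltration, pow_zero]) W ?_
  simpa [smul_smul, inv_mul_cancel₀ hc0] using W.smul_mem c⁻¹ hw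

variable [IsScalarTower k E R]

theorem actOn_sandwich_le (V : Submodule k R) (m : ℕ) (W : Submodule k R) :
    actOn k (sandwich T V m) W ≤ V ^ m * W * V ^ m := by
  refine actOn_le.2 fun t ht w hw => ?_
  induction ht using Submodule.span_induction with
  | mem t ht =>
    obtain ⟨p, hp, q, hq, rfl⟩ := ht
    rw [T.tmul_smul]
    exact Submodule.mul_mem_mul (Submodule.mul_mem_mul hp hw) hq
  | zero => rw [zero_smul]; exact zero_mem _
  | add s t _ _ hs ht => rw [add_smul]; exact add_mem hs ht
  | smul c t _ ht => rw [smul_assoc]; exact Submodule.smul_mem _ _ ht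

include T in
theorem span_enveloping_eq_top {x : R} {X : Set R} (hx : x ∈ X)
    (h : (1 : R) ∈ (⊤ : Submodule k R) * Submodule.span k {x} * ⊤) :
    Submodule.span E X = ⊤ := by
  have h1 : (1 : R) ∈ Submodule.span E X := by
    suffices H : (⊤ : Submodule k R) * Submodule.span k {x} * ⊤ ≤
        (Submodule.span E X).restrictScalars k from H h
    refine Submodule.mul_le.2 fun y hy q _ => ?_
    induction hy using Submodule.mul_induction_on' with
    | mem_mul_mem p _ z hz =>
      obtain ⟨c, rfl⟩ := Submodule.mem_span_singleton.1 hz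
      rw [mul_smul_comm, smul_mul_assoc, ← T.tmul_smul, ← smul_assoc]
      exact Submodule.smul_mem _ _ (Submodule.subset_span hx)
    | add y _ z _ hy hz => rw [add_mul]; exact add_mem hy hz
  refine eq_top_iff.2 fun y _ => ?_
  have := Submodule.smul_mem _ (T.tmul y 1) h1
  rwa [T.tmul_smul, mul_one, mul_one] at this

theorem exists_mem_pow_mul_mul_pow {V : Submodule k R} (h1 : 1 ≤ V)
    (hV : ∀ a : R, ∃ n, a ∈ V ^ n) (X : Submodule k R) {z : R} (hz : z ∈ ⊤ * X * ⊤) :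
    ∃ n, z ∈ V ^ n * X * V ^ n := by
  have hmono : ∀ {m n : ℕ}, m ≤ n → V ^ m * X * V ^ m ≤ V ^ n * X * V ^ n := fun h =>
    mul_le_mul' (mul_le_mul' (pow_le_pow_right₀ h1 h) le_rfl) (pow_le_pow_right₀ h1 h)
  have hadd : ∀ {y z : R}, (∃ n, y ∈ V ^ n * X * V ^ n) → (∃ n, z ∈ V ^ n * X * V ^ n) →
      ∃ n, y + z ∈ V ^ n * X * V ^ n := by
    rintro y z ⟨m, hm⟩ ⟨n, hn⟩
    exact ⟨max m n, add_mem (hmono (le_max_left _ _) hm) (hmono (le_max_right _ _) hn)⟩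
  induction hz using Submodule.mul_induction_on' with
  | mem_mul_mem y hy q _ =>
    induction hy using Submodule.mul_induction_on' with
    | mem_mul_mem p _ x hx =>
      obtain ⟨m, hm⟩ := hV p
      obtain ⟨n, hn⟩ := hV q
      exact ⟨max m n, Submodule.mul_mem_mul (Submodule.mul_mem_mul
        (pow_le_pow_right₀ h1 (le_max_left _ _) hm) hx)
        (pow_le_pow_right₀ h1 (le_max_right _ _) hn)⟩
    | add y _ z _ hy hz => rw [add_mul]; exact hadd hy hz
  | add y _ z _ hy hz => exact hadd hy hz

include T in
/-- Quantitative simplicity extracted from a bound on the filter dimension. -/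
theorem exists_return_of_moduleFilterDim_lt [Nontrivial R] (V : Submodule k R) [FiniteDimensional k V]
    (h1 : (1 : R) ∈ V) (hV : ∀ a : R, ∃ n, a ∈ V ^ n)
    (hs : ∀ a : R, a ≠ 0 → (1 : R) ∈ (⊤ : Submodule k R) * Submodule.span k {a} * ⊤)
    {r : EReal} (hr : moduleFilterDim k E R < r) :
    ∃ r₁ : ℝ, (r₁ : EReal) < r ∧ ∃ m : R, m ≠ 0 ∧ ∃ s c : ℕ, 0 < c ∧
      ∀ i, ∀ a ∈ V ^ i, a ≠ 0 → ∀ N, c * (i + 1) ≤ N →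
        ∃ j ≤ ⌊(N : ℝ) ^ r₁⌋₊, m ∈ V ^ (s * j) * Submodule.span k {a} * V ^ (s * j) := by
  have hone : 1 ≤ V := Submodule.one_le.2 h1
  simp only [moduleFilterDim, gammaExp, iInf_lt_iff] at hr
  obtain ⟨S, hS, M₀, hM₀, hspan, r₁, hf, hr₁⟩ := hr
  refine ⟨r₁, hr₁, ?_⟩
  obtain ⟨m, hmM, hm0⟩ : ∃ m ∈ M₀, m ≠ 0 := by
    by_contra! h
    have : (M₀ : Set R) ⊆ {0} := fun x hx => h x hx
    have h' : Submodule.span E (M₀ : Set R) = ⊥ := by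
      rw [Submodule.span_eq_bot]; exact fun x hx => h x hx
    exact bot_ne_top (h'.symm.trans hspan)
  obtain ⟨s, hs'⟩ := exists_stdFiltration_le_sandwich T hone hV S
  obtain ⟨n₀, hn₀⟩ := Filter.eventually_atTop.1 hf
  have hVS : ∀ t : E, ∃ n, t ∈ Submodule.span k (insert 1 (S : Set E)) ^ n :=
    exists_mem_pow_of_adjoin_eq_top (Submodule.subset_span (Set.mem_insert _ _))
      ((Set.subset_insert _ _).trans Submodule.subset_span) hS
  have hone' := one_le_span_insert_one (k := k) (S : Set E)
  obtain ⟨c₁, hc₁⟩ := exists_mem_pow_of_finiteDimensional hone' hVS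
    (V.map (T.tmul.flip 1))
  obtain ⟨c₂, hc₂⟩ := exists_mem_actOn_pow hone' hVS M₀ (x := (1 : R)) (hspan ▸ trivial)
  -- As a = (a ⊗ 1) • 1, it lies in step c₁ i + c₂ of the filtration of R defined by M₀; n₀ puts N
  -- in the range where the return function is bounded. The test space is the line through a.
  refine ⟨m, hm0, s, c₁ + c₂ + n₀ + 1, by omega, fun i a ha ha0 N hN => ?_⟩
  have hN0 : n₀ ≤ N := by nlinarith
  obtain ⟨j, hj, hj'⟩ := exists_le_of_returnFunction_le (by positivity) (hn₀ N hN0)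
  refine ⟨j, hj, ?_⟩
  refine actOn_sandwich_le T V (s * j) _ (actOn_mono (hs' j) le_rfl
    (hj' (Submodule.span k {a}) inferInstance ?_ ?_ hmM))
  · rw [Submodule.span_singleton_le_iff_mem]
    have ha1 := pow_le_pow_left' hc₁ i (T.tmul_left_mem_pow ha)
    rw [← pow_mul] at ha1
    have h := smul_mem_actOn_mul ha1 hc₂
    have h2 : T.tmul a 1 • (1 : R) = a := by rw [T.tmul_smul, mul_one, mul_one]
    rw [h2, ← pow_add] at h
    exact actOn_mono (pow_le_pow_right₀ hone' (by nlinarith)) le_rfl h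
  · exact span_enveloping_eq_top T (Submodule.mem_span_singleton_self a) (hs a ha0)

-- The filter dimension returns a to a fixed nonzero m only; going on from m to 1 costs a constant
-- t. Replacing r₁ by its maximum with 0 makes the bound monotone and stays below r because r > 0.
include T in
theorem exists_returnBound_of_moduleFilterDim_lt [Nontrivial R] (V : Submodule k R)
    [FiniteDimensional k V] (h1 : (1 : R) ∈ V) (hV : ∀ a : R, ∃ n, a ∈ V ^ n)
    (hs : ∀ a : R, a ≠ 0 → (1 : R) ∈ (⊤ : Submodule k R) * Submodule.span k {a} * ⊤)
    {r : ℝ} (hr0 : 0 < r) (hr : moduleFilterDim k E R < r) :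
    ∃ r₁ : ℝ, 0 ≤ r₁ ∧ r₁ < r ∧ ∃ c : ℕ,
      ReturnBound V fun i => c * (⌊((c * (i + 1) : ℕ) : ℝ) ^ r₁⌋₊ + 1) := by
  have hone : 1 ≤ V := Submodule.one_le.2 h1
  obtain ⟨r₁, hr₁, m, hm0, s, c, hc0, hc⟩ := exists_return_of_moduleFilterDim_lt T V h1 hV hs hr
  obtain ⟨t, ht⟩ := exists_mem_pow_mul_mul_pow hone hV _ (hs m hm0)
  refine ⟨max r₁ 0, le_max_right _ _, max_lt (by exact_mod_cast hr₁) hr0, c + s + t,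
    fun i a ha ha0 => ?_⟩
  obtain ⟨j, hj, hmj⟩ := hc i a ha ha0 ((c + s + t) * (i + 1)) (by gcongr; omega)
  have hj' : j ≤ ⌊(((c + s + t) * (i + 1) : ℕ) : ℝ) ^ max r₁ 0⌋₊ := by
    refine hj.trans (Nat.floor_le_floor ?_)
    refine Real.rpow_le_rpow_of_exponent_le ?_ (le_max_left _ _)
    exact_mod_cast Nat.mul_pos (by omega) (Nat.succ_pos i)
  have h2 : (1 : R) ∈ V ^ (t + s * j) * Submodule.span k {a} * V ^ (s * j + t) := by
    have : V ^ (t + s * j) * Submodule.span k {a} * V ^ (s * j + t) =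
        V ^ t * (V ^ (s * j) * Submodule.span k {a} * V ^ (s * j)) * V ^ t := by
      simp only [pow_add, mul_assoc]
    rw [this]
    refine mem_mul_of_le (mul_le_mul' le_rfl ?_) le_rfl ht
    rwa [Submodule.span_singleton_le_iff_mem]
  have h3 : s * j + t ≤ (c + s + t) * (⌊(((c + s + t) * (i + 1) : ℕ) : ℝ) ^ max r₁ 0⌋₊ + 1) := by
    calc s * j + t ≤ (c + s + t) * j + (c + s + t) :=
          add_le_add (Nat.mul_le_mul_right _ (by omega)) (by omega)
      _ = (c + s + t) * (j + 1) := by ring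
      _ ≤ _ := Nat.mul_le_mul_left _ (Nat.succ_le_succ hj')
  exact mem_mul_of_le (mul_le_mul' (pow_le_pow_right₀ hone ((add_comm _ _).trans_le h3)) le_rfl)
    (pow_le_pow_right₀ hone h3) h2

-- Take as generators the elements v ⊗ 1 and 1 ⊗ v, and M₀ = k. Step i then reaches only V²ⁱ, and
-- tensors with both factors in Vⁿ lie in step 2n; these are the two factors 2 in the hypothesis.
include T in
theorem moduleFilterDim_le [Nontrivial R] (V : Submodule k R) [FiniteDimensional k V] (h1 : (1 : R) ∈ V)
    (hV : ∀ a : R, ∃ n, a ∈ V ^ n) {F : ℕ → ℕ} (hF : ReturnBound V F) {r : ℝ}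
    (hr : ∀ᶠ i : ℕ in Filter.atTop, ((2 * F (2 * i) : ℕ) : ℝ) ≤ (i : ℝ) ^ r) :
    moduleFilterDim k E R ≤ r := by
  classical
  have hone : 1 ≤ V := Submodule.one_le.2 h1
  obtain ⟨s, hs⟩ := Module.Finite.iff_fg.1 (inferInstance : FiniteDimensional k V)
  let S : Finset E := s.image (T.tmul.flip 1) ∪ s.image (T.tmul 1)
  have hone' := one_le_span_insert_one (k := k) (S : Set E)
  have hleft : ∀ n, ∀ p ∈ V ^ n, T.tmul p 1 ∈ stdFiltration k S n := by
    intro n p hp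
    suffices H : V.map (T.tmul.flip 1) ≤ Submodule.span k (insert 1 (S : Set E)) from
      pow_le_pow_left' H n (T.tmul_left_mem_pow hp)
    rw [← hs, Submodule.map_span]
    refine Submodule.span_mono ?_
    rintro _ ⟨x, hx, rfl⟩
    exact Set.mem_insert_of_mem _ (Finset.mem_union_left _ (Finset.mem_image_of_mem _ hx))
  have hright : ∀ n, ∀ p ∈ V ^ n, T.tmul 1 p ∈ stdFiltration k S n := by
    intro n p hp
    suffices H : V.map (T.tmul 1) ≤ Submodule.span k (insert 1 (S : Set E)) from
      pow_le_pow_left' H n (T.tmul_right_mem_pow hp)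
    rw [← hs, Submodule.map_span]
    refine Submodule.span_mono ?_
    rintro _ ⟨x, hx, rfl⟩
    exact Set.mem_insert_of_mem _ (Finset.mem_union_right _ (Finset.mem_image_of_mem _ hx))
  have hboth : ∀ n, ∀ p ∈ V ^ n, ∀ q ∈ V ^ n,
      T.tmul p q ∈ stdFiltration k S (2 * n) := by
    intro n p hp q hq
    have : T.tmul p q = T.tmul p 1 * T.tmul 1 q := by rw [T.tmul_mul_tmul, mul_one, mul_one]
    rw [this, stdFiltration, two_mul, pow_add]
    exact Submodule.mul_mem_mul (hleft n p hp) (hright n q hq)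
  have hadj : ∀ n, stdFiltration k S n ≤
      Subalgebra.toSubmodule (Algebra.adjoin k (S : Set E)) := by
    intro n
    rw [Algebra.adjoin_eq_span]
    induction n with
    | zero =>
      rw [stdFiltration, pow_zero, Submodule.one_le]
      exact Submodule.subset_span (Submonoid.one_mem _)
    | succ n ih =>
      rw [← Algebra.adjoin_eq_span] at ih ⊢
      rw [stdFiltration, pow_succ]
      refine Submodule.mul_le.2 fun x hx y hy => Subalgebra.mul_mem _ (ih hx) ?_
      refine (Submodule.span_le (p := Subalgebra.toSubmodule (Algebra.adjoin k
        (S : Set E)))).2 (Set.insert_subset ?_ Algebra.subset_adjoin) hy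
      exact one_mem (Algebra.adjoin k (S : Set E))
  have hgen : Algebra.adjoin k (S : Set E) = ⊤ := by
    refine eq_top_iff.2 fun t _ => ?_
    obtain ⟨n, hn⟩ := exists_mem_sandwich T hone hV t
    refine hadj (2 * n) ((Submodule.span_le (p := stdFiltration k S (2 * n))).2 ?_ hn)
    rintro _ ⟨p, hp, q, hq, rfl⟩
    exact hboth n p hp q hq
  have hstd : ∀ i, stdFiltration k S i ≤ sandwich T V i := by
    intro i
    refine (pow_le_pow_left' ?_ i).trans ((sandwich_pow_le T V 1 i).trans (by rw [one_mul]))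
    refine Submodule.span_le.2 (Set.insert_subset ?_ fun t ht => ?_)
    · rw [← T.tmul_one_one]
      exact tmul_mem_sandwich T (by rwa [pow_one]) (by rwa [pow_one])
    · have hsV : ∀ x ∈ s, x ∈ V := fun x hx => hs ▸ Submodule.subset_span hx
      rcases Finset.mem_union.1 ht with ht | ht
      · obtain ⟨x, hx, rfl⟩ := Finset.mem_image.1 ht
        exact tmul_mem_sandwich T (by rw [pow_one]; exact hsV x hx) (by rwa [pow_one])
      · obtain ⟨x, hx, rfl⟩ := Finset.mem_image.1 ht
        exact tmul_mem_sandwich T (by rwa [pow_one]) (by rw [pow_one]; exact hsV x hx)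
  have hspan : Submodule.span E ((Submodule.span k {(1 : R)} : Submodule k R) : Set R)
      = ⊤ := by
    refine span_enveloping_eq_top T (Submodule.mem_span_singleton_self (1 : R)) ?_
    have := Submodule.mul_mem_mul (Submodule.mul_mem_mul (Submodule.mem_top (R := k) (x := (1 : R)))
      (Submodule.mem_span_singleton_self (R := k) (1 : R)))
      (Submodule.mem_top (R := k) (x := (1 : R)))
    simpa only [mul_one] using this
  refine le_trans (iInf_le_of_le S (iInf_le_of_le hgen (iInf_le_of_le (Submodule.span k {1})
    (iInf_le_of_le inferInstance (iInf_le _ hspan))))) (gammaExp_le ?_)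
  filter_upwards [hr] with i hi
  refine ⟨2 * F (2 * i), returnFunction_le fun W _ hW hWspan => ?_, hi⟩
  obtain ⟨w, hw, hw0⟩ : ∃ w ∈ W, w ≠ 0 := by
    by_contra! h
    have h' : Submodule.span E (W : Set R) = ⊥ := by
      rw [Submodule.span_eq_bot]; exact fun x hx => h x hx
    exact bot_ne_top (h'.symm.trans hWspan)
  have hwV : w ∈ V ^ (2 * i) := by
    have h := actOn_sandwich_le T V i _ (actOn_mono (hstd i) le_rfl (hW hw))
    rwa [← Submodule.one_eq_span, mul_one, ← pow_add, ← two_mul] at h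
  rw [Submodule.span_singleton_le_iff_mem]
  suffices H : V ^ F (2 * i) * Submodule.span k {w} * V ^ F (2 * i) ≤
      actOn k (stdFiltration k S (2 * F (2 * i))) W from H (hF _ w hwV hw0)
  refine Submodule.mul_le.2 fun x hx q hq => ?_
  induction hx using Submodule.mul_induction_on' with
  | mem_mul_mem p hp z hz =>
    rw [← T.tmul_smul]
    exact smul_mem_actOn (hboth _ p hp q hq)
      ((Submodule.span_singleton_le_iff_mem w W).2 hw hz)
  | add x _ y _ hx hy => rw [add_mul]; exact add_mem hx hy

-- A negative exponent forces the return step to be 0, so a fixed nonzero m lies on the line through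
-- each nonzero a, and R is one-dimensional.
include T in
theorem mem_span_one_of_moduleFilterDim_neg [Nontrivial R] (V : Submodule k R) [FiniteDimensional k V]
    (h1 : (1 : R) ∈ V) (hV : ∀ a : R, ∃ n, a ∈ V ^ n)
    (hs : ∀ a : R, a ≠ 0 → (1 : R) ∈ (⊤ : Submodule k R) * Submodule.span k {a} * ⊤)
    (h : moduleFilterDim k E R < 0) (a : R) : a ∈ Submodule.span k {(1 : R)} := by
  obtain ⟨r₁, hr₁, m, hm0, s, c, hc0, hc⟩ := exists_return_of_moduleFilterDim_lt T V h1 hV hs h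
  have hr₁' : r₁ < 0 := by exact_mod_cast hr₁
  have key : ∀ a : R, a ≠ 0 → m ∈ Submodule.span k {a} := by
    intro a ha
    obtain ⟨i, hi⟩ := hV a
    -- The added 1 makes the base exceed 1, so its negative power has floor 0.
    obtain ⟨j, hj, hmj⟩ := hc i a hi ha (c * (i + 1) + 1) (Nat.le_succ _)
    have : ⌊((c * (i + 1) + 1 : ℕ) : ℝ) ^ r₁⌋₊ = 0 := by
      refine Nat.floor_eq_zero.2 (Real.rpow_lt_one_of_one_lt_of_neg ?_ hr₁')
      have : 0 < c * (i + 1) := Nat.mul_pos hc0 (Nat.succ_pos i)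
      exact_mod_cast Nat.lt_add_of_pos_left this
    rw [this, Nat.le_zero] at hj
    simpa [hj] using hmj
  by_cases ha : a = 0
  · rw [ha]; exact zero_mem _
  obtain ⟨t, rfl⟩ := Submodule.mem_span_singleton.1 (key 1 one_ne_zero)
  obtain ⟨u, hu⟩ := Submodule.mem_span_singleton.1 (key a ha)
  have hu0 : u ≠ 0 := by rintro rfl; exact hm0 (by rw [← hu, zero_smul])
  refine Submodule.mem_span_singleton.2 ⟨u⁻¹ * t, ?_⟩
  rw [mul_smul, ← hu, smul_smul, inv_mul_cancel₀ hu0, one_smul]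

end Sandwich

end FilterDim

namespace FilterDim

/-! ### Growth and the Gelfand-Kirillov dimension -/

section Growth

theorem eventually_mul_rpow_le {a b K : ℝ} (ha : 0 ≤ a) (hab : a < b) :
    ∀ᶠ n : ℕ in Filter.atTop, K * ((n : ℝ) ^ a + 1) ≤ (n : ℝ) ^ b := by
  have h := ((tendsto_rpow_atTop (sub_pos.2 hab)).comp
    (tendsto_natCast_atTop_atTop (R := ℝ))).eventually_ge_atTop (2 * |K|)
  filter_upwards [h, Filter.eventually_ge_atTop 1] with n hn hn1
  have hn1' : (1 : ℝ) ≤ n := by exact_mod_cast hn1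
  have h1 : (1 : ℝ) ≤ (n : ℝ) ^ a := Real.one_le_rpow hn1' ha
  have h2 : (n : ℝ) ^ b = (n : ℝ) ^ (b - a) * (n : ℝ) ^ a := by
    rw [← Real.rpow_add (by positivity), sub_add_cancel]
  simp only [Function.comp_apply] at hn
  rw [h2]
  calc K * ((n : ℝ) ^ a + 1) ≤ |K| * ((n : ℝ) ^ a + (n : ℝ) ^ a) := by
        gcongr
        exact le_abs_self K
    _ = 2 * |K| * (n : ℝ) ^ a := by ring
    _ ≤ _ := by gcongr

theorem floor_rpow_le {L α n : ℕ} {a : ℝ} (ha : 0 ≤ a) (hL : L ≤ α * n) :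
    (⌊(L : ℝ) ^ a⌋₊ : ℝ) ≤ (α : ℝ) ^ a * (n : ℝ) ^ a := by
  refine (Nat.floor_le (by positivity)).trans ?_
  rw [← Real.mul_rpow (by positivity) (by positivity)]
  exact Real.rpow_le_rpow (by positivity) (by exact_mod_cast hL) ha

theorem growthExponent_le {d : ℕ → ℕ} {s : ℝ}
    (h : ∀ᶠ n : ℕ in Filter.atTop, Real.log (d n) ≤ s * Real.log n) :
    growthExponent d ≤ s := by
  refine Filter.limsup_le_of_le (h := ?_)
  filter_upwards [h, Filter.eventually_ge_atTop 2] with n hn hn2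
  have : 0 < Real.log n := Real.log_pos (by exact_mod_cast hn2)
  exact_mod_cast (div_le_iff₀ this).2 hn

theorem eventually_log_le_of_growthExponent_lt {d : ℕ → ℕ} {s : ℝ} (h : growthExponent d < s) :
    ∀ᶠ n : ℕ in Filter.atTop, Real.log (d n) ≤ s * Real.log n := by
  filter_upwards [Filter.eventually_lt_of_limsup_lt h, Filter.eventually_ge_atTop 2] with n hn hn2
  have : 0 < Real.log n := Real.log_pos (by exact_mod_cast hn2)
  exact (div_le_iff₀ this).1 (by exact_mod_cast hn.le)

theorem one_le_growthExponent {d : ℕ → ℕ} (h : ∀ n, n ≤ d n) : 1 ≤ growthExponent d := by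
  refine le_trans ?_ Filter.liminf_le_limsup
  refine Filter.le_liminf_of_le (h := ?_)
  filter_upwards [Filter.eventually_ge_atTop 2] with n hn2
  have h0 : 0 < Real.log n := Real.log_pos (by exact_mod_cast hn2)
  have : (1 : ℝ) ≤ Real.log (d n) / Real.log n := by
    rw [one_le_div h0]
    exact Real.log_le_log (by positivity) (by exact_mod_cast h n)
  exact_mod_cast this

end Growth

/-! ### A dimension inequality for modules over a quantitatively simple algebra. -/

section GelfandKirillov

variable {k R M : Type*} [Field k] [Ring R] [Algebra k R] [AddCommGroup M] [Module k M]
  [Module R M] [IsScalarTower k R M]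

theorem finiteDimensional_actOn (V : Submodule k R) (F : Submodule k M) [FiniteDimensional k V]
    [FiniteDimensional k F] : FiniteDimensional k (actOn k V F) := by
  have := IsScalarTower.to_smulCommClass (R := k) (A := R) (M := M)
  have h : actOn k V F = Submodule.map₂ (Algebra.lsmul k k M).toLinearMap V F := by
    refine le_antisymm (actOn_le.2 fun v hv m hm => ?_) (Submodule.map₂_le.2 fun v hv m hm => ?_)
    · exact Submodule.apply_mem_map₂ (Algebra.lsmul k k M).toLinearMap hv hm
    · exact smul_mem_actOn hv hm
  rw [h]
  exact Module.Finite.iff_fg.2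
    (Submodule.FG.map₂ _ (Module.Finite.iff_fg.1 ‹_›) (Module.Finite.iff_fg.1 ‹_›))

/-- Elements of Dⁱ act as linear maps DᵐM₀ → Dᵐ⁺ⁱM₀. A nonzero b acting as zero would make Dᵐ b Dᵐ,
and with it 1, annihilate M₀. -/
theorem finrank_pow_le_mul [Nontrivial M] (D : Submodule k R) [FiniteDimensional k D]
    (M₀ : Submodule k M) [FiniteDimensional k M₀] (hM₀ : Submodule.span R (M₀ : Set M) = ⊤)
    {i m : ℕ} (h : ∀ b ∈ D ^ i, b ≠ 0 → (1 : R) ∈ D ^ m * Submodule.span k {b} * D ^ m) :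
    Module.finrank k (D ^ i : Submodule k R) ≤
      Module.finrank k (actOn k (D ^ m) M₀) * Module.finrank k (actOn k (D ^ (m + i)) M₀) := by
  have := IsScalarTower.to_smulCommClass (R := k) (A := R) (M := M)
  have := finiteDimensional_actOn (D ^ m) M₀
  have := finiteDimensional_actOn (D ^ (m + i)) M₀
  let φ : (D ^ i : Submodule k R) →ₗ[k] (actOn k (D ^ m) M₀ →ₗ[k] actOn k (D ^ (m + i)) M₀) :=
    LinearMap.mk₂ k (fun b x => ⟨(b : R) • (x : M), by
        rw [add_comm, pow_add]; exact smul_mem_actOn_mul b.2 x.2⟩)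
      (fun b b' x => Subtype.ext (add_smul _ _ _))
      (fun c b x => Subtype.ext (smul_assoc _ _ _))
      (fun b x x' => Subtype.ext (smul_add _ _ _))
      (fun c b x => Subtype.ext (smul_comm _ _ _))
  rw [← Module.finrank_linearMap k k]
  refine LinearMap.finrank_le_finrank_of_injective (f := φ) ?_
  rw [← LinearMap.ker_eq_bot, eq_bot_iff]
  intro b hb
  by_contra hb0
  have hb0' : (b : R) ≠ 0 := fun h0 => hb0 ((Submodule.mem_bot k).2 (Subtype.ext h0))
  have hbx : ∀ x ∈ actOn k (D ^ m) M₀, (b : R) • x = 0 := fun x hx =>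
    congrArg Subtype.val (LinearMap.congr_fun (LinearMap.mem_ker.1 hb) ⟨x, hx⟩)
  have hzero : ∀ y ∈ M₀, y = 0 := by
    intro y hy
    have key : ∀ z ∈ D ^ m * Submodule.span k {(b : R)} * D ^ m, z • y = 0 := by
      intro z hz
      induction hz using Submodule.mul_induction_on' with
      | mem_mul_mem x hx q hq =>
        have hqy := smul_mem_actOn hq hy
        induction hx using Submodule.mul_induction_on' with
        | mem_mul_mem p _ w hw =>
          obtain ⟨c, rfl⟩ := Submodule.mem_span_singleton.1 hw
          rw [mul_assoc, mul_smul, mul_smul, smul_assoc, hbx _ hqy, smul_zero, smul_zero]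
        | add x _ x' _ hx hx' => rw [add_mul, add_smul, hx, hx', add_zero]
      | add x _ x' _ hx hx' => rw [add_smul, hx, hx', add_zero]
    simpa using key 1 (h b b.2 hb0')
  have hbot : Submodule.span R (M₀ : Set M) = ⊥ := by
    rw [Submodule.span_eq_bot]; exact hzero
  exact bot_ne_top (hbot.symm.trans hM₀)

/-- With m near a power of n of exponent below s, the two factors in `finrank_pow_le_mul` contribute
exponents γ s₁ and γ(1 + s − s₁), in total γ(1 + s). -/
theorem gkDim_le_of_returnBound [Nontrivial R] [Nontrivial M] [Module.Finite R M]
    (D : Submodule k R) [FiniteDimensional k D] (h1 : (1 : R) ∈ D) (hD : ∀ a : R, ∃ n, a ∈ D ^ n)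
    {c : ℕ} {r s γ : ℝ} (hr : 0 ≤ r) (hrs : r < s) (hs : s < 1)
    (hF : ReturnBound D fun i => c * (⌊((c * (i + 1) : ℕ) : ℝ) ^ r⌋₊ + 1))
    (hγ : 0 ≤ γ) (hM : gkDimModule k R M < γ) : gkDim k R ≤ ((γ * (1 + s) : ℝ) : EReal) := by
  have hone : 1 ≤ D := Submodule.one_le.2 h1
  obtain ⟨X, hX⟩ := (Module.Finite.fg_top : (⊤ : Submodule R M).FG)
  have hM₀ : Submodule.span R ((Submodule.span k (X : Set M) : Submodule k M) : Set M) = ⊤ :=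
    eq_top_iff.2 (hX ▸ Submodule.span_mono Submodule.subset_span)
  have hfin : FiniteDimensional k (Submodule.span k (X : Set M)) :=
    FiniteDimensional.span_finset k X
  generalize Submodule.span k (X : Set M) = M₀ at hM₀ hfin
  let d : ℕ → ℕ := fun n => Module.finrank k (actOn k (D ^ n) M₀)
  have hd : growthExponent d < γ := by
    refine lt_of_le_of_lt ?_ hM
    exact le_iSup_of_le D (le_iSup_of_le ⟨inferInstance, h1⟩
      (le_iSup_of_le M₀ (le_iSup_of_le hfin le_rfl)))
  have hd' := eventually_log_le_of_growthExponent_lt hd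
  refine iSup₂_le fun V hV => growthExponent_le ?_
  obtain ⟨hVfin, hV1⟩ := hV
  obtain ⟨e, he⟩ := exists_mem_pow_of_finiteDimensional hone hD V
  -- The gap between r and s₁ absorbs the constants of the return bound; the gap between s₁ and s
  -- absorbs the factor e in m + e n.
  let s₁ := (r + s) / 2
  have hrs₁ : r < s₁ := by simp only [s₁]; linarith
  have hs₁ : s₁ < s := by simp only [s₁]; linarith
  have hs₁0 : 0 < s₁ := hr.trans_lt hrs₁
  have hm_top : Filter.Tendsto (fun n : ℕ => ⌊(n : ℝ) ^ s₁⌋₊) Filter.atTop Filter.atTop :=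
    tendsto_nat_floor_atTop.comp ((tendsto_rpow_atTop hs₁0).comp tendsto_natCast_atTop_atTop)
  have hn_top : Filter.Tendsto (fun n : ℕ => ⌊(n : ℝ) ^ s₁⌋₊ + e * n) Filter.atTop Filter.atTop :=
    Filter.tendsto_atTop_mono (fun n => Nat.le_add_right _ _) hm_top
  filter_upwards [hm_top.eventually hd', hn_top.eventually hd', Filter.eventually_ge_atTop 1,
    eventually_mul_rpow_le (K := c * ((c * (e + 1) : ℕ) : ℝ) ^ r + c) hr hrs₁,
    eventually_mul_rpow_le (K := e + 1) zero_le_one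
      (show (1 : ℝ) < 1 + (s - s₁) by linarith),
    hm_top.eventually_ge_atTop 1] with n hn₁ hn₂ hn hK₁ hK₂ hm1
  have hn' : (1 : ℝ) ≤ n := by exact_mod_cast hn
  have hlog : 0 ≤ Real.log n := Real.log_nonneg hn'
  set m := ⌊(n : ℝ) ^ s₁⌋₊ with hm
  have hmle : (m : ℝ) ≤ (n : ℝ) ^ s₁ := Nat.floor_le (by positivity)
  have hFm : c * (⌊((c * (e * n + 1) : ℕ) : ℝ) ^ r⌋₊ + 1) ≤ m := by
    refine Nat.le_floor ?_
    push_cast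
    have hfl := floor_rpow_le (L := c * (e * n + 1)) (α := c * (e + 1)) (n := n) hr (by
      rw [mul_assoc]; exact Nat.mul_le_mul_left _ (by nlinarith))
    have h1n : 1 ≤ (n : ℝ) ^ r := Real.one_le_rpow hn' hr
    push_cast at hfl hK₁
    refine le_trans ?_ hK₁
    have hc : (0 : ℝ) ≤ c := Nat.cast_nonneg c
    have hx : (0 : ℝ) ≤ (c * (e + 1) : ℝ) ^ r := by positivity
    have := mul_le_mul_of_nonneg_left hfl hc
    nlinarith [mul_nonneg hc hx, mul_nonneg hc (zero_le_one.trans h1n)]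
  have hdim : Module.finrank k (V ^ n : Submodule k R) ≤ d m * d (m + e * n) := by
    refine le_trans (Submodule.finrank_mono ?_) (finrank_pow_le_mul D M₀ hM₀ (i := e * n) ?_)
    · rw [pow_mul]; exact pow_le_pow_left' he n
    · intro b hb hb0
      have hpow := pow_le_pow_right₀ hone hFm
      exact mem_mul_of_le (mul_le_mul' hpow le_rfl) hpow (hF _ b hb hb0)
  have hpos : 0 < Module.finrank k (V ^ n : Submodule k R) := by
    refine Module.finrank_pos_iff_exists_ne_zero.2
      ⟨⟨1, Submodule.one_le.1 (one_le_pow₀ (Submodule.one_le.2 hV1))⟩, fun h => ?_⟩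
    exact one_ne_zero (congrArg Subtype.val h)
  have hd0 : d m ≠ 0 ∧ d (m + e * n) ≠ 0 := by
    rw [← mul_ne_zero_iff]
    omega
  have hm1' : (1 : ℝ) ≤ m := by exact_mod_cast hm1
  have hlog₁ : Real.log m ≤ s₁ * Real.log n := by
    rw [← Real.log_rpow (by positivity)]
    exact Real.log_le_log (by positivity) hmle
  have hlog₂ : Real.log ((m + e * n : ℕ) : ℝ) ≤ (1 + (s - s₁)) * Real.log n := by
    rw [← Real.log_rpow (by positivity)]
    refine Real.log_le_log (by positivity) (le_trans ?_ hK₂)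
    have : (n : ℝ) ^ s₁ ≤ n := by
      simpa using Real.rpow_le_rpow_of_exponent_le hn' (hs₁.trans hs).le
    push_cast
    rw [Real.rpow_one]
    have he0 : (0 : ℝ) ≤ e := Nat.cast_nonneg e
    nlinarith
  calc Real.log (Module.finrank k (V ^ n : Submodule k R))
      ≤ Real.log ((d m : ℝ) * (d (m + e * n) : ℝ)) :=
        Real.log_le_log (by exact_mod_cast hpos) (by exact_mod_cast hdim)
    _ = Real.log (d m) + Real.log (d (m + e * n)) :=
        Real.log_mul (by exact_mod_cast hd0.1) (by exact_mod_cast hd0.2)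
    _ ≤ γ * Real.log m + γ * Real.log ((m + e * n : ℕ) : ℝ) := add_le_add hn₁ hn₂
    _ ≤ γ * (s₁ * Real.log n) + γ * ((1 + (s - s₁)) * Real.log n) := by gcongr
    _ = γ * (1 + s) * Real.log n := by ring

/-- Powers of the frame increase strictly: a repetition would make them stationary and R
finite-dimensional. Hence dim Dⁿ ≥ n. -/
theorem one_le_gkDim (D : Submodule k R) [FiniteDimensional k D] (h1 : (1 : R) ∈ D)
    (hD : ∀ a : R, ∃ n, a ∈ D ^ n) (hR : ¬ FiniteDimensional k R) : 1 ≤ gkDim k R := by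
  have hone : 1 ≤ D := Submodule.one_le.2 h1
  have hlt : ∀ n, D ^ n < D ^ (n + 1) := by
    intro n
    refine lt_of_le_of_ne (pow_le_pow_right₀ hone (Nat.le_succ n)) fun h => hR ?_
    have hstab : ∀ m, D ^ (n + m) = D ^ n := by
      intro m
      induction m with
      | zero => rfl
      | succ m ih => rw [← add_assoc, pow_succ, ih, ← pow_succ, ← h]
    have htop : D ^ n = ⊤ := by
      refine eq_top_iff.2 fun a _ => ?_
      obtain ⟨m, hm⟩ := hD a
      rw [← hstab m]
      exact pow_le_pow_right₀ hone (Nat.le_add_left m n) hm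
    have hfin : FiniteDimensional k (D ^ n : Submodule k R) := inferInstance
    rw [htop] at hfin
    exact Module.finite_def.2 ((Submodule.fg_top _).1 (Module.finite_def.1 hfin))
  have hle : ∀ n, n ≤ Module.finrank k (D ^ n : Submodule k R) := by
    intro n
    induction n with
    | zero => exact Nat.zero_le _
    | succ n ih => exact Nat.succ_le_of_lt (ih.trans_lt (Submodule.finrank_lt_finrank_of_lt (hlt n)))
  exact (one_le_growthExponent hle).trans
    (le_iSup_of_le D (le_iSup_of_le ⟨inferInstance, h1⟩ le_rfl))

/-- A simple algebra of filter dimension less than one has no nonzero finitely generated module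
whose dimension is at most half of the dimension of the algebra. -/
theorem not_gkDimModule_le_half [Nontrivial R] [Nontrivial M] [Module.Finite R M]
    (D : Submodule k R) [FiniteDimensional k D] (h1 : (1 : R) ∈ D) (hD : ∀ a : R, ∃ n, a ∈ D ^ n)
    (hR : ¬ FiniteDimensional k R) {c : ℕ} {r : ℝ} (hr : 0 ≤ r) (hr1 : r < 1)
    (hF : ReturnBound D fun i => c * (⌊((c * (i + 1) : ℕ) : ℝ) ^ r⌋₊ + 1))
    (hM : gkDimModule k R M ≠ ⊤) :
    ¬ gkDimModule k R M ≤ ((1 / 2 : ℝ) : EReal) * gkDim k R := by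
  intro hle
  have hg1 := one_le_gkDim D h1 hD hR
  obtain ⟨s, hrs, hs1⟩ := exists_between hr1
  obtain ⟨t, hst, ht1⟩ := exists_between hs1
  -- Finiteness comes first, from any real γ above GK(M), so that the comparison below takes place
  -- in real numbers.
  have hfin : gkDim k R ≠ ⊤ := by
    obtain ⟨γ, hγ, -⟩ := EReal.lt_iff_exists_real_btwn.1
      (max_lt (lt_top_iff_ne_top.2 hM) (EReal.coe_lt_top 0))
    have := gkDim_le_of_returnBound (M := M) D h1 hD hr hrs hs1 hF
      (γ := γ) (by exact_mod_cast ((le_max_right _ _).trans_lt hγ).le)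
      ((le_max_left _ _).trans_lt hγ)
    exact ne_top_of_le_ne_top (EReal.coe_ne_top _) this
  have hbot : gkDim k R ≠ ⊥ := fun h => by
    rw [h] at hg1; exact absurd hg1 (not_le.2 (EReal.bot_lt_coe 1))
  lift gkDim k R to ℝ using ⟨hfin, hbot⟩ with x hx
  have hx1 : 1 ≤ x := by exact_mod_cast hg1
  have ht0 : 0 < 1 + t := by linarith
  -- As x > 0 and t < 1, x/2 < x/(1 + t). The inequality then gives x ≤ x(1 + s)/(1 + t), which is
  -- absurd since s < t.
  have hlt : gkDimModule k R M < ((x / (1 + t) : ℝ) : EReal) := by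
    refine lt_of_le_of_lt hle ?_
    rw [← EReal.coe_mul, EReal.coe_lt_coe_iff, lt_div_iff₀ ht0]
    nlinarith
  have := gkDim_le_of_returnBound (M := M) D h1 hD hr hrs hs1 hF (by positivity) hlt
  rw [← hx, EReal.coe_le_coe_iff, div_mul_eq_mul_div, le_div_iff₀ ht0] at this
  nlinarith

end GelfandKirillov

end FilterDim

namespace FilterDim

/-! ### The enveloping algebra -/

/-- The left side is 2F'(2i), where F' is the bound that `exists_invariant_frame` derives from the
one in `exists_returnBound_of_moduleFilterDim_lt`. -/
theorem eventually_return_le {c C : ℕ} {r₁ r : ℝ} (h0 : 0 ≤ r₁) (hr : r₁ < r) :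
    ∀ᶠ i : ℕ in Filter.atTop,
      ((2 * (C * (c * (⌊((c * (C * (2 * i + 1) + 1) : ℕ) : ℝ) ^ r₁⌋₊ + 1) + 1)) : ℕ) : ℝ) ≤
        (i : ℝ) ^ r := by
  filter_upwards [eventually_mul_rpow_le
    (K := 2 * (C * (c * ((c * (3 * C + 1) : ℕ) : ℝ) ^ r₁ + c + 1))) h0 hr,
    Filter.eventually_ge_atTop 1] with i hi hi1
  refine le_trans ?_ hi
  have hfl := floor_rpow_le (L := c * (C * (2 * i + 1) + 1)) (α := c * (3 * C + 1)) (n := i) h0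
    (by rw [mul_assoc]; exact Nat.mul_le_mul_left _ (by nlinarith))
  have hy : 0 ≤ ((c * (3 * C + 1) : ℕ) : ℝ) ^ r₁ := by positivity
  generalize ((c * (3 * C + 1) : ℕ) : ℝ) ^ r₁ = y at *
  have hz : 0 ≤ (i : ℝ) ^ r₁ := by positivity
  generalize (i : ℝ) ^ r₁ = z at *
  have hc : (0 : ℝ) ≤ c := Nat.cast_nonneg c
  have h1 : (c : ℝ) * (⌊((c * (C * (2 * i + 1) + 1) : ℕ) : ℝ) ^ r₁⌋₊ + 1) + 1 ≤
      (c * y + c + 1) * (z + 1) := by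
    nlinarith [mul_le_mul_of_nonneg_left hfl hc, mul_nonneg hc hy, mul_nonneg hc hz]
  rw [Nat.cast_mul, Nat.cast_mul, Nat.cast_add, Nat.cast_mul, Nat.cast_add, Nat.cast_one,
    Nat.cast_ofNat]
  calc _ ≤ 2 * ((C : ℝ) * ((c * y + c + 1) * (z + 1))) := by gcongr
    _ = _ := by ring

section Enveloping

variable {k R : Type*} [Field k] [Ring R] [Algebra k R]

attribute [local instance] TensorProduct.Algebra.module

theorem isScalarTower_enveloping : IsScalarTower k (R ⊗[k] Rᵐᵒᵖ) R := by
  refine ⟨fun c t x => ?_⟩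
  induction t using TensorProduct.induction_on with
  | zero =>
    have h : (0 : R ⊗[k] Rᵐᵒᵖ) • x = 0 := zero_smul (R ⊗[k] Rᵐᵒᵖ) x
    rw [smul_zero, h, smul_zero]
  | tmul p q =>
    rw [TensorProduct.smul_tmul', TensorProduct.Algebra.smul_def, TensorProduct.Algebra.smul_def,
      smul_assoc]
  | add s t hs ht => rw [smul_add, add_smul, hs, ht, add_smul, smul_add]

/-- The enveloping algebra with its action on `R`. -/
def envelopingAction (k R : Type*) [Field k] [Ring R] [Algebra k R] :
    SandwichAction k R (R ⊗[k] Rᵐᵒᵖ) where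
  tmul := (TensorProduct.mk k R Rᵐᵒᵖ).compl₂ (MulOpposite.opLinearEquiv k).toLinearMap
  tmul_smul p q x := by
    change (p ⊗ₜ[k] MulOpposite.op q) • x = _
    rw [TensorProduct.Algebra.smul_def, MulOpposite.smul_eq_mul_unop, smul_eq_mul, mul_assoc]
    rfl
  tmul_mul_tmul p q p' q' := by
    change (p ⊗ₜ[k] MulOpposite.op q) * (p' ⊗ₜ[k] MulOpposite.op q') = _
    rw [Algebra.TensorProduct.tmul_mul_tmul]
    rfl
  tmul_one_one := rfl
  span_eq_top := by
    rw [← top_le_iff, ← TensorProduct.span_tmul_eq_top]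
    refine Submodule.span_mono ?_
    rintro _ ⟨p, q, rfl⟩
    exact ⟨p, q.unop, rfl⟩

/-- The whole algebra is a frame with constant return bound, so any positive exponent works; 1/2 is
an arbitrary choice below 1. -/
theorem filterDim_lt_one [Nontrivial R] [FiniteDimensional k R]
    (hs : ∀ a : R, a ≠ 0 → (1 : R) ∈ (⊤ : Submodule k R) * Submodule.span k {a} * ⊤) :
    filterDim k R < 1 := by
  let _ := TensorProduct.Algebra.module (R := k) (A := R) (B := Rᵐᵒᵖ) (M := R)
  have := isScalarTower_enveloping (k := k) (R := R)
  have h : filterDim k R ≤ ((1 / 2 : ℝ) : EReal) := by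
    refine moduleFilterDim_le (envelopingAction k R) ⊤ trivial (fun a => ⟨1, by simp⟩)
      (F := fun _ => 1) (fun i a _ ha => by simpa only [pow_one] using hs a ha) ?_
    filter_upwards [eventually_mul_rpow_le (K := 2) le_rfl (show (0 : ℝ) < 1 / 2 by norm_num)]
      with i hi
    rw [Real.rpow_zero] at hi
    push_cast
    linarith
  refine h.trans_lt ?_
  exact_mod_cast (show (1 / 2 : ℝ) < 1 by norm_num)

end Enveloping

/-! ### The two inequalities for the algebra of invariants. -/

section Main

variable {k A G : Type*} [Field k] [CharZero k] [Ring A] [Algebra k A] [IsSimpleRing A]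
  [Algebra.FiniteType k A] [IsNoetherianRing A] [Group G] [Finite G] [MulSemiringAction G A]
  [SMulCommClass G k A]

theorem filterDim_fixedPoints_le (hG : ActsByOuter G A) :
    filterDim k (FixedPoints.subalgebra k A G) ≤ filterDim k A := by
  cases nonempty_fintype G
  let _ := TensorProduct.Algebra.module (R := k) (A := A) (B := Aᵐᵒᵖ) (M := A)
  let _ := TensorProduct.Algebra.module (R := k) (A := FixedPoints.subalgebra k A G)
    (B := (FixedPoints.subalgebra k A G)ᵐᵒᵖ) (M := FixedPoints.subalgebra k A G)
  have := isScalarTower_enveloping (k := k) (R := A)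
  have := isScalarTower_enveloping (k := k) (R := FixedPoints.subalgebra k A G)
  obtain ⟨V, hVfin, h1, hV, hGV⟩ := exists_stable_frame (k := k) (A := A) (G := G)
  obtain ⟨D, hDfin, hD1, hD, C, hC⟩ := exists_invariant_frame hG V h1 hV hGV
  have hs : ∀ a : A, a ≠ 0 → (1 : A) ∈ (⊤ : Submodule k A) * Submodule.span k {a} * ⊤ :=
    fun a ha => one_mem_top_mul_span_mul_top ha
  -- The transfer of return bounds is informative for positive exponents only. A negative filter
  -- dimension means A = k, and then the invariants are also k, with filter dimension −∞.
  by_cases hneg : filterDim k A < 0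
  · have hA := mem_span_one_of_moduleFilterDim_neg (envelopingAction k A) V h1 hV hs hneg
    have hB : filterDim k (FixedPoints.subalgebra k A G) = ⊥ := by
      refine moduleFilterDim_eq_bot (envelopingAction k (FixedPoints.subalgebra k A G)) fun b => ?_
      obtain ⟨c, hc⟩ := Submodule.mem_span_singleton.1 (hA b)
      exact Submodule.mem_span_singleton.2 ⟨c, Subtype.ext hc⟩
    rw [hB]
    exact bot_le
  · refine EReal.le_of_forall_lt_iff_le.1 fun r hr => ?_
    have hr0 : 0 < r := by exact_mod_cast (not_lt.1 hneg).trans_lt hr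
    obtain ⟨r₁, hr₁, hr₁r, c, hc⟩ :=
      exists_returnBound_of_moduleFilterDim_lt (envelopingAction k A) V h1 hV hs hr0 hr
    refine moduleFilterDim_le (envelopingAction k (FixedPoints.subalgebra k A G)) D hD1 hD
      (hC _ ?_ hc) (eventually_return_le hr₁ hr₁r)
    intro i j hij
    refine Nat.mul_le_mul_left _ (Nat.succ_le_succ (Nat.floor_le_floor ?_))
    refine Real.rpow_le_rpow (by positivity) ?_ hr₁
    exact_mod_cast Nat.mul_le_mul_left _ (Nat.succ_le_succ hij)

theorem one_le_filterDim_fixedPoints (hG : ActsByOuter G A) (hA : filterDim k A = 1)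
    {M : Type*} [AddCommGroup M] [Module k M] [Module (FixedPoints.subalgebra k A G) M]
    [IsScalarTower k (FixedPoints.subalgebra k A G) M] [Nontrivial M]
    [Module.Finite (FixedPoints.subalgebra k A G) M]
    (hM : gkDimModule k (FixedPoints.subalgebra k A G) M ≠ ⊤)
    (hle : gkDimModule k (FixedPoints.subalgebra k A G) M
      ≤ ((1 / 2 : ℝ) : EReal) * gkDim k (FixedPoints.subalgebra k A G)) :
    1 ≤ filterDim k (FixedPoints.subalgebra k A G) := by
  cases nonempty_fintype G
  by_contra hlt
  let _ := TensorProduct.Algebra.module (R := k) (A := FixedPoints.subalgebra k A G)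
    (B := (FixedPoints.subalgebra k A G)ᵐᵒᵖ) (M := FixedPoints.subalgebra k A G)
  have := isScalarTower_enveloping (k := k) (R := FixedPoints.subalgebra k A G)
  obtain ⟨V, hVfin, h1, hV, hGV⟩ := exists_stable_frame (k := k) (A := A) (G := G)
  obtain ⟨D, hDfin, hD1, hD, -, -⟩ := exists_invariant_frame hG V h1 hV hGV
  -- This is where fdim A = 1 enters: finite-dimensional invariants would make A finite-dimensional,
  -- hence fdim A < 1.
  have hB : ¬ FiniteDimensional k (FixedPoints.subalgebra k A G) := by
    intro hfin
    have := finiteDimensional_of_fixedPoints (k := k) hG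
    exact (filterDim_lt_one (R := A)
      fun a ha => one_mem_top_mul_span_mul_top (k := k) ha).ne hA
  obtain ⟨r, hr, hr1, c, hc⟩ := exists_returnBound_of_moduleFilterDim_lt
    (envelopingAction k (FixedPoints.subalgebra k A G)) D hD1 hD (fixedPoints_one_mem hG)
    one_pos (lt_of_not_ge hlt)
  exact not_gkDimModule_le_half D hD1 hD hB hr hr1 hc hM hle

end Main

end FilterDim

theorem proposition4p4 (k : Type*) [Field k] [CharZero k]
    (A : Type*) [Ring A] [Algebra k A] [IsSimpleRing A] [Algebra.FiniteType k A]
    [IsNoetherianRing A] [IsNoetherianRing Aᵐᵒᵖ]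
    (G : Type*) [Group G] [Finite G] [MulSemiringAction G A] [SMulCommClass G k A]
    (hG : FilterDim.ActsByOuter G A) :
    FilterDim.filterDim k (FixedPoints.subalgebra k A G) ≤ FilterDim.filterDim k A ∧
    (FilterDim.filterDim k A = 1 →
      (∃ (M : Type*) (_ : AddCommGroup M) (_ : Module k M)
        (_ : Module (FixedPoints.subalgebra k A G) M)
        (_ : IsScalarTower k (FixedPoints.subalgebra k A G) M),
        Nontrivial M ∧ Module.Finite (FixedPoints.subalgebra k A G) M ∧
        FilterDim.gkDimModule k (FixedPoints.subalgebra k A G) M ≠ ⊤ ∧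
        FilterDim.gkDimModule k (FixedPoints.subalgebra k A G) M
          ≤ ((1 / 2 : ℝ) : EReal) * FilterDim.gkDim k (FixedPoints.subalgebra k A G)) →
      FilterDim.filterDim k (FixedPoints.subalgebra k A G) = FilterDim.filterDim k A) := by
  refine ⟨FilterDim.filterDim_fixedPoints_le hG, fun hA => ?_⟩
  rintro ⟨M, _, _, _, _, _, _, hM, hle⟩
  exact le_antisymm (FilterDim.filterDim_fixedPoints_le hG)
    (hA.le.trans (FilterDim.one_le_filterDim_fixedPoints hG hA hM hle))
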